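/- Let $[n]=\{1,\dots,n\}$, and for distributions $p,q$ over $[n]$ let $\mathrm{TV}(p,q)=\max_{S\subseteq[n]}|p(S)-q(S)|$. An algorithm here is randomized, draws a fixed number of i.i.d. samples from an unknown distribution $p$ over $[n]$, and is given the descriptions of a known distribution $q$ over $[n]$ and, in the augmented case, of a prediction $\hat p$ over $[n]$; the number of samples may depend on the known data. For fixed $q$ and $\hat p$, an algorithm with answers accept, reject, inaccurate is called $(\alpha,\epsilon,\delta)$-correct for $(q,\hat p)$ if for every $p$ over $[n]$: - if $\mathrm{TV}(p,\hat p)\le\alpha$, it answers inaccurate with probability at most $\delta/2$; - if $p=q$, it answers reject with probability at most $\delta/2$; - if $\mathrm{TV}(p,q)>\epsilon$, it answers accept with probability at most $\delta/2$. It is an $(\alpha,\epsilon,\delta)$-augmented identity tester if it is $(\alpha,\epsilon,\delta)$-correct for all $q,\hat p$. A standard identity tester with error $\eta$ answers accept or reject; it rejects with probability at most $\eta$ if $p=q$, and accepts with probability at most $\eta$ if $\mathrm{TV}(p,q)>\epsilon$. Put $d=\mathrm{TV}(q,\hat p)$ and $$R(n,\alpha,\epsilon,d)=\begin{cases}\sqrt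 n/\epsilon^2 & \text{if } d\le\alpha,\\ \min\left(1/(d-\alpha)^2,\ \sqrt n/\epsilon^2\right)&\text{if } d>\alpha,\end{cases}$$ where $\sqrt n/\epsilon^2=\infty$ if $\epsilon=0$. **Algorithm** (with a constant $K>0$ and a standard identity tester $T$). If $d\le\alpha$ or $1/(d-\alpha)^2>\sqrt n/\epsilon^2$, return the answer of $T$ on $q$ and samples from $p$. Otherwise let $S=\{x:\hat p(x)<q(x)\}$, draw $m=\lceil K/(d-\alpha)^2\rceil$ samples from $p$, let $\sigma$ be the fraction of them in $S$, and answer reject if $|q(S)-\sigma|>(d-\alpha)/4$ and inaccurate otherwise. **Theorem.** 1. There are standard identity testers with error $0.05$, for all $n$ and all $\epsilon\in(0,1]$, that use at most $C\sqrt n/\epsilon^2$ samples for an absolute constant $C$. 2. There is an absolute constant $K_0>0$ such that for every $K\ge K_0$ and every $C\ge 0$ there is a constant $C'$, depending only on $K$ and $C$, for which the following holds. If $T$ is a family of testers as in 1 with constant $C$, then for all $n$, $\alpha\in[0,1]$ and $\epsilon\in(0,1]$ the Algorithm is an $(\alpha,\epsilon,0.1)$-augmented identity tester, and it uses at most $C'\,R(n,\alpha,\epsilon,d)$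 samples for all $q,\hat p$ over $[n]$. 3. The same number of samples is necessary, even when $q$ is the uniform distribution $U_n$ over $[n]$. For every $\delta\in(0,2/3)$ there is a constant $c>0$, depending only on $\delta$, such that for all $n\ge1$, $\alpha\in[0,1]$ and $\epsilon\in[0,1/2]$ with $\epsilon<1-1/n$: - for every $\hat p$ over $[n]$ with $d=\mathrm{TV}(U_n,\hat p)\le\alpha$, every algorithm that is $(\alpha,\epsilon,\delta)$-correct for $(U_n,\hat p)$ uses at least $c\,R(n,\alpha,\epsilon,d)$ samples; - for every real $d$ with $\alpha<d\le 1/2$ there is $\hat p$ over $[n]$ with $\mathrm{TV}(U_n,\hat p)=d$ such that every algorithm that is $(\alpha,\epsilon,\delta)$-correct for $(U_n,\hat p)$ uses at least $c\,R(n,\alpha,\epsilon,d)$ samples. In particular, these bounds hold for the number of samples that any $(\alpha,\epsilon,\delta)$-augmented identity tester uses on $(U_n,\hat p)$. -/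

import Mathlib

open scoped ENNReal NNReal

noncomputable section

namespace AugTest

/-- The probability mass `p(S)` of a set `S ⊆ [n]` under a distribution `p` over `[n]`. -/
def mass {n : ℕ} (p : PMF (Fin n)) (S : Finset (Fin n)) : ℝ :=
  ∑ i ∈ S, (p i).toReal

/-- Total variation distance: the supremum over all `S ⊆ [n]` of `|p(S) - q(S)|`. The supremum is
over a finite nonempty family, so it is a maximum. -/
def tv {n : ℕ} (p q : PMF (Fin n)) : ℝ :=
  ⨆ S : Finset (Fin n), |mass p S - mass q S|

/-- A randomized algorithm that draws a fixed number of samples from a distribution over `[n]` and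
answers in `O`: for each sample sequence, `out` gives the law of the answer over the internal
randomness of the algorithm. -/
structure SampleAlg (n : ℕ) (O : Type) where
  samples : ℕ
  out : (Fin samples → Fin n) → PMF O

/-- The probability that the algorithm answers `o` when its samples are i.i.d. from `p`. -/
def SampleAlg.prob {n : ℕ} {O : Type} (A : SampleAlg n O) (p : PMF (Fin n)) (o : O) : ℝ :=
  ∑ x : Fin A.samples → Fin n, (∏ j, (p (x j)).toReal) * (A.out x o).toReal

/-- Answers of a standard tester. -/
inductive Verdict : Type
  | accept
  | reject

/-- Answers of an augmented tester. -/
inductive Answer : Type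
  | accept
  | reject
  | inaccurate

/-- A verdict of a standard tester, read as an answer of an augmented tester. -/
def Verdict.toAnswer : Verdict → Answer
  | .accept => .accept
  | .reject => .reject

/-- A standard identity tester with proximity parameter `ε` and error probability `η`: it is given
the description of `q` and has sample access to `p`. -/
def IsStandardIdentityTester {n : ℕ} (ε η : ℝ) (T : PMF (Fin n) → SampleAlg n Verdict) : Prop :=
  ∀ q p : PMF (Fin n),
    (p = q → (T q).prob p .reject ≤ η) ∧
    (ε < tv p q → (T q).prob p .accept ≤ η)

/-- The three requirements on an augmented tester once the known distributions `q` and `phat` are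
fixed; the unknown distribution `p` is arbitrary. -/
def IsAugmentedFor {n : ℕ} (α ε δ : ℝ) (q phat : PMF (Fin n)) (A : SampleAlg n Answer) : Prop :=
  ∀ p : PMF (Fin n),
    (tv p phat ≤ α → A.prob p .inaccurate ≤ δ / 2) ∧
    (p = q → A.prob p .reject ≤ δ / 2) ∧
    (ε < tv p q → A.prob p .accept ≤ δ / 2)

/-- An `(α, ε, δ)`-augmented tester for identity testing over `[n]`: it is given the descriptions
of `q` and of the prediction `phat` and has sample access to `p`. -/
def IsAugmentedIdentityTester {n : ℕ} (α ε δ : ℝ)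
    (A : PMF (Fin n) → PMF (Fin n) → SampleAlg n Answer) : Prop :=
  ∀ q phat : PMF (Fin n), IsAugmentedFor α ε δ q phat (A q phat)

/-- The Scheffé set of `phat` and `q`: all `x` with `phat x < q x`. -/
def scheffeSet {n : ℕ} (q phat : PMF (Fin n)) : Finset (Fin n) :=
  Finset.univ.filter fun x => phat x < q x

/-- The fraction of the samples that lie in `S`. -/
def sampleFraction {n m : ℕ} (S : Finset (Fin n)) (x : Fin m → Fin n) : ℝ :=
  ((Finset.univ.filter fun j => x j ∈ S).card : ℝ) / m

/-- The branch of the augmented tester that uses the prediction: draw `m = ⌈K / (d - α)²⌉` samples,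
where `d` is the total variation distance of `q` and `phat`, estimate the mass of the Scheffé set,
and answer `reject` if the estimate differs from its mass under `q` by more than `(d - α) / 4`,
and `inaccurate` otherwise. -/
def scheffeBranch {n : ℕ} (K α : ℝ) (q phat : PMF (Fin n)) : SampleAlg n Answer where
  samples := ⌈K / (tv q phat - α) ^ 2⌉₊
  out x :=
    if (tv q phat - α) / 4 <
        |mass q (scheffeSet q phat) - sampleFraction (scheffeSet q phat) x| then
      PMF.pure .reject
    else
      PMF.pure .inaccurate

/-- The branch that returns the answer of the standard tester. -/
def standardBranch {n : ℕ} (T : SampleAlg n Verdict) : SampleAlg n Answer where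
  samples := T.samples
  out x := (T.out x).map Verdict.toAnswer

open scoped Classical in
/-- The augmented identity tester of the paper. Here `T` is the standard identity tester that it
calls (for the same `n` and `ε`), and `K` is the constant hidden in its number of samples
`m = O(1 / (d - α)²)`. -/
def augmentedIdentityTester {n : ℕ} (K : ℝ) (T : PMF (Fin n) → SampleAlg n Verdict) (α ε : ℝ)
    (q phat : PMF (Fin n)) : SampleAlg n Answer :=
  if tv q phat ≤ α ∨ 1 / (tv q phat - α) ^ 2 > √(n : ℝ) / ε ^ 2 then
    standardBranch (T q)
  else
    scheffeBranch K α q phat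

/-- `√n / ε²` as an extended nonnegative real; it is `∞` if `ε = 0` and `n ≠ 0`. -/
def standardRate (n : ℕ) (ε : ℝ) : ℝ≥0∞ :=
  ENNReal.ofReal √(n : ℝ) / ENNReal.ofReal (ε ^ 2)

open scoped Classical in
/-- The sample complexity of augmented identity testing, up to constants: `√n / ε²` if `d ≤ α`, and
`min (1 / (d - α)²) (√n / ε²)` if `α < d`. -/
def augmentedRate (n : ℕ) (α ε d : ℝ) : ℝ≥0∞ :=
  if d ≤ α then standardRate n ε
  else min (1 / ENNReal.ofReal ((d - α) ^ 2)) (standardRate n ε)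

end AugTest

end

open scoped ENNReal NNReal

noncomputable section

namespace AugTest

/-! ### Expectations under i.i.d. samples -/

/-! Standard tester. Split the samples into two independent batches of size `m` and pair their
centred counts with weights `1 / w i`. By independence `pairStat` has mean `m ^ 2 * ∑ i, (p i - q i)
^ 2 / w i`, with no diagonal bias to correct. Taking `w` halfway between `q` and uniform does two
things: Cauchy–Schwarz bounds the squared `ℓ¹` distance by this chi-square type distance
(`sq_sum_abs_le_chiDist`), and `w ≥ 1 / (2n)`, `w ≥ q / 2` control the variance
(`variance_pairStat_le`, `sum_sq_div_le`, `sum_mul_sq_div_le`). Chebyshev then needs only `m` of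
order `√n / ε ^ 2`.

Augmented tester. The Scheffé set `S` attains `q(S) - phat(S) = d`. If `p` is within `α` of `phat`,
then `p(S) ≤ q(S) - (d - α)`, whereas `p = q` gives `p(S) = q(S)`; estimating `p(S)` to within `(d -
α) / 4` separates the two. This branch never accepts and the standard branch never answers
inaccurate, so each has only the remaining errors to control.

Lower bound. Under the uniform law the three answers have total probability one, and reject has
probability at most `δ / 2`. With few samples some far `p` makes accept almost as likely as under
uniform (`exists_far`), so accept has probability at most `δ / 2 + γ`. If `d ≤ α`, inaccurate is
bounded by `δ / 2` directly; if `α < d`, take `phat` at distance `d` along a fixed direction and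
compare uniform with the point at distance `d - α` along it (`iidExp_uniform_le_balanced`). The
total is at most `3 * δ / 2 + 2 * γ < 1`, a contradiction. Both comparisons rest on the second
moment of a likelihood ratio (`exists_iidExp_uniform_le`), applied to a random perturbation of
blocks of four elements or to a single perturbed law. -/

/-- The expectation of `f` when its arguments are i.i.d. with probability vector `p`. -/
def iidExp {ι κ : Type*} [Fintype ι] [DecidableEq ι] [Fintype κ] (p : κ → ℝ)
    (f : (ι → κ) → ℝ) : ℝ :=
  ∑ x : ι → κ, (∏ j, p (x j)) * f x

section iidExp

variable {ι κ : Type*} [Fintype ι] [DecidableEq ι] [Fintype κ] {p : κ → ℝ}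

theorem iidExp_prod (p : κ → ℝ) (g : ι → κ → ℝ) :
    iidExp p (fun x => ∏ j, g j (x j)) = ∏ j, ∑ i, p i * g j i := by
  simp only [iidExp, ← Finset.prod_mul_distrib]
  exact (Fintype.prod_sum fun j i => p i * g j i).symm

theorem iidExp_const (hp : ∑ i, p i = 1) (c : ℝ) :
    iidExp p (fun _ : ι → κ => c) = c := by
  have h := iidExp_prod (ι := ι) p (fun _ _ => 1)
  simp only [mul_one, hp, Finset.prod_const_one, iidExp] at h
  simp only [iidExp, ← Finset.sum_mul, h, one_mul]

theorem iidExp_add (f g : (ι → κ) → ℝ) :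
    iidExp p (fun x => f x + g x) = iidExp p f + iidExp p g := by
  simp only [iidExp, mul_add, Finset.sum_add_distrib]

theorem iidExp_sub (f g : (ι → κ) → ℝ) :
    iidExp p (fun x => f x - g x) = iidExp p f - iidExp p g := by
  simp only [iidExp, mul_sub, Finset.sum_sub_distrib]

theorem iidExp_const_mul (c : ℝ) (f : (ι → κ) → ℝ) :
    iidExp p (fun x => c * f x) = c * iidExp p f := by
  simp only [iidExp, Finset.mul_sum]
  exact Finset.sum_congr rfl fun x _ => by ring

theorem iidExp_sum {τ : Type*} (s : Finset τ) (f : τ → (ι → κ) → ℝ) :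
    iidExp p (fun x => ∑ t ∈ s, f t x) = ∑ t ∈ s, iidExp p (f t) := by
  simp only [iidExp, Finset.mul_sum]
  exact Finset.sum_comm

theorem iidExp_mono (hp : ∀ i, 0 ≤ p i) {f g : (ι → κ) → ℝ} (h : ∀ x, f x ≤ g x) :
    iidExp p f ≤ iidExp p g :=
  Finset.sum_le_sum fun x _ =>
    mul_le_mul_of_nonneg_left (h x) (Finset.prod_nonneg fun j _ => hp (x j))

theorem iidExp_coord (hp : ∑ i, p i = 1) (u : κ → ℝ) (j : ι) :
    iidExp p (fun x : ι → κ => u (x j)) = ∑ i, p i * u i := by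
  have h := iidExp_prod (ι := ι) p (fun l i => if l = j then u i else 1)
  simp only [Finset.prod_ite_eq', Finset.mem_univ, if_true] at h
  rw [h, Finset.prod_eq_single j]
  · simp
  · intro l _ hl
    simp [hl, hp]
  · simp

theorem iidExp_coord_mul (hp : ∑ i, p i = 1) (u v : κ → ℝ) {j k : ι} (hjk : j ≠ k) :
    iidExp p (fun x : ι → κ => u (x j) * v (x k)) = (∑ i, p i * u i) * ∑ i, p i * v i := by
  have h := iidExp_prod (ι := ι) p
    (fun l i => (if l = j then u i else 1) * (if l = k then v i else 1))
  simp only [Finset.prod_mul_distrib, Finset.prod_ite_eq', Finset.mem_univ, if_true] at h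
  rw [h, ← Finset.prod_subset (Finset.subset_univ {j, k}), Finset.prod_pair hjk]
  · simp [hjk, hjk.symm]
  · intro l _ hl
    simp only [Finset.mem_insert, Finset.mem_singleton, not_or] at hl
    simp [hl.1, hl.2, hp]

theorem iidExp_sum_coord (hp : ∑ i, p i = 1) (u : κ → ℝ) :
    iidExp p (fun x : ι → κ => ∑ j, u (x j)) = Fintype.card ι * ∑ i, p i * u i := by
  rw [iidExp_sum]
  simp [iidExp_coord hp]

/-- Every pair of samples contributes the product of the means; only a sample paired with itself
adds the covariance of `u` and `v`. -/
theorem iidExp_sum_mul_sum (hp : ∑ i, p i = 1) (u v : κ → ℝ) :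
    iidExp p (fun x : ι → κ => (∑ j, u (x j)) * ∑ k, v (x k)) =
      Fintype.card ι * (∑ i, p i * (u i * v i) - (∑ i, p i * u i) * ∑ i, p i * v i) +
        (Fintype.card ι : ℝ) ^ 2 * ((∑ i, p i * u i) * ∑ i, p i * v i) := by
  have key : ∀ j k : ι, iidExp p (fun x : ι → κ => u (x j) * v (x k)) =
      (if j = k then ∑ i, p i * (u i * v i) - (∑ i, p i * u i) * ∑ i, p i * v i else 0) +
        (∑ i, p i * u i) * ∑ i, p i * v i := by
    intro j k
    by_cases h : j = k
    · subst h
      simp [iidExp_coord hp (fun i => u i * v i) j]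
    · simp [h, iidExp_coord_mul hp u v h]
  simp only [Finset.sum_mul_sum, iidExp_sum, key, Finset.sum_add_distrib, Finset.sum_ite_eq,
    Finset.mem_univ, if_true, Finset.sum_const, Finset.card_univ, nsmul_eq_mul]
  ring

/-- Chebyshev's inequality. -/
theorem iidExp_chebyshev (hp : ∀ i, 0 ≤ p i) (Z : (ι → κ) → ℝ) (μ : ℝ) {t : ℝ} (ht : 0 < t)
    (φ : (ι → κ) → ℝ) (h1 : ∀ x, φ x ≤ 1) (h0 : ∀ x, |Z x - μ| < t → φ x ≤ 0) :
    iidExp p φ ≤ iidExp p (fun x => (Z x - μ) ^ 2) / t ^ 2 := by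
  rw [div_eq_inv_mul, ← iidExp_const_mul]
  refine iidExp_mono hp fun x => ?_
  by_cases h : |Z x - μ| < t
  · exact (h0 x h).trans (by positivity)
  · refine (h1 x).trans ?_
    rw [inv_mul_eq_div, le_div_iff₀ (by positivity), one_mul]
    rw [← sq_abs (Z x - μ)]
    exact pow_le_pow_left₀ ht.le (not_lt.1 h) 2

theorem iidExp_sq_sub (hp : ∑ i, p i = 1) (Z : (ι → κ) → ℝ) (μ : ℝ) (hμ : iidExp p Z = μ) :
    iidExp p (fun x => (Z x - μ) ^ 2) = iidExp p (fun x => Z x ^ 2) - μ ^ 2 := by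
  have : (fun x => (Z x - μ) ^ 2) = fun x => (Z x ^ 2 - (2 * μ) * Z x) + μ ^ 2 := by
    funext x; ring
  rw [this, iidExp_add, iidExp_sub, iidExp_const_mul, iidExp_const hp, hμ]
  ring

/-- Independence of the first and the last samples. -/
theorem iidExp_append (m m' : ℕ) (p : κ → ℝ) (f : (Fin m → κ) → ℝ) (g : (Fin m' → κ) → ℝ) :
    iidExp p (fun x : Fin (m + m') → κ =>
      f (fun j => x (Fin.castAdd m' j)) * g (fun j => x (Fin.natAdd m j))) =
      iidExp p f * iidExp p g := by
  unfold iidExp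
  rw [← (Fin.appendEquiv m m').sum_comp, Fintype.sum_prod_type, Finset.sum_mul_sum]
  refine Finset.sum_congr rfl fun x _ => Finset.sum_congr rfl fun y _ => ?_
  simp only [Fin.prod_univ_add, Fin.appendEquiv, Equiv.coe_fn_mk, Fin.append_left,
    Fin.append_right]
  ring

end iidExp

/-! ### Probability vectors and total variation -/

section Vectors

variable {n : ℕ}

/-- The probability vector of a distribution. -/
def vec (p : PMF (Fin n)) (i : Fin n) : ℝ := (p i).toReal

theorem vec_nonneg (p : PMF (Fin n)) (i : Fin n) : 0 ≤ vec p i := ENNReal.toReal_nonneg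

theorem sum_toReal {O : Type*} [Fintype O] (p : PMF O) : ∑ i, (p i).toReal = 1 := by
  rw [← ENNReal.toReal_sum fun i _ => p.apply_ne_top i, ← tsum_fintype (L := .unconditional _),
    p.tsum_coe, ENNReal.toReal_one]

theorem sum_vec (p : PMF (Fin n)) : ∑ i, vec p i = 1 := sum_toReal p

theorem exists_vec_eq (v : Fin n → ℝ) (h0 : ∀ i, 0 ≤ v i) (h1 : ∑ i, v i = 1) :
    ∃ p : PMF (Fin n), vec p = v := by
  refine ⟨PMF.ofFintype (fun i => ENNReal.ofReal (v i)) ?_, ?_⟩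
  · rw [← ENNReal.ofReal_sum_of_nonneg fun i _ => h0 i, h1, ENNReal.ofReal_one]
  · funext i
    simp [vec, ENNReal.toReal_ofReal (h0 i)]

theorem vec_uniform [NeZero n] (i : Fin n) :
    vec (PMF.uniformOfFintype (Fin n)) i = 1 / n := by
  simp [vec]

theorem mass_eq (p : PMF (Fin n)) (S : Finset (Fin n)) : mass p S = ∑ i ∈ S, vec p i := rfl

theorem mass_nonneg (p : PMF (Fin n)) (S : Finset (Fin n)) : 0 ≤ mass p S :=
  Finset.sum_nonneg fun i _ => vec_nonneg p i

theorem mass_le_one (p : PMF (Fin n)) (S : Finset (Fin n)) : mass p S ≤ 1 := by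
  rw [← sum_vec p]
  exact Finset.sum_le_sum_of_subset_of_nonneg (Finset.subset_univ S) fun i _ _ => vec_nonneg p i

theorem abs_mass_sub_le_tv (p q : PMF (Fin n)) (S : Finset (Fin n)) :
    |mass p S - mass q S| ≤ tv p q :=
  le_ciSup (f := fun S : Finset (Fin n) => |mass p S - mass q S|) (Set.finite_range _).bddAbove S

theorem tv_le_one (p q : PMF (Fin n)) : tv p q ≤ 1 :=
  ciSup_le fun S => abs_le.2
    ⟨by linarith [mass_nonneg p S, mass_le_one q S], by linarith [mass_nonneg q S, mass_le_one p S]⟩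

theorem mem_scheffeSet (q phat : PMF (Fin n)) (i : Fin n) :
    i ∈ scheffeSet q phat ↔ vec phat i < vec q i := by
  simp only [scheffeSet, Finset.mem_filter, Finset.mem_univ, true_and, vec]
  exact (ENNReal.toReal_lt_toReal (phat.apply_ne_top i) (q.apply_ne_top i)).symm

/-- The differences `vec p i - vec q i` sum to zero, so `S` and its complement carry the same
absolute discrepancy and each is bounded by its own share of the `ℓ¹` norm. -/
theorem abs_mass_sub_le_half (p q : PMF (Fin n)) (S : Finset (Fin n)) :
    |mass p S - mass q S| ≤ (∑ i, |vec p i - vec q i|) / 2 := by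
  have e : mass p S - mass q S = ∑ i ∈ S, (vec p i - vec q i) := by
    rw [Finset.sum_sub_distrib]; rfl
  have e' : mass p S - mass q S = - ∑ i ∈ Sᶜ, (vec p i - vec q i) := by
    have := Finset.sum_add_sum_compl S fun i => vec p i - vec q i
    rw [Finset.sum_sub_distrib (s := Finset.univ), sum_vec, sum_vec] at this
    rw [e]; linarith
  have a1 : |mass p S - mass q S| ≤ ∑ i ∈ S, |vec p i - vec q i| := by
    rw [e]; exact Finset.abs_sum_le_sum_abs _ _
  have a2 : |mass p S - mass q S| ≤ ∑ i ∈ Sᶜ, |vec p i - vec q i| := by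
    rw [e', abs_neg]; exact Finset.abs_sum_le_sum_abs _ _
  have := Finset.sum_add_sum_compl S fun i => |vec p i - vec q i|
  linarith

theorem mass_scheffeSet_sub (q phat : PMF (Fin n)) :
    mass q (scheffeSet q phat) - mass phat (scheffeSet q phat) =
      (∑ i, |vec q i - vec phat i|) / 2 := by
  set S := scheffeSet q phat with hS
  have e : mass q S - mass phat S = ∑ i ∈ S, (vec q i - vec phat i) := by
    rw [Finset.sum_sub_distrib]; rfl
  have h0 := Finset.sum_add_sum_compl S fun i => vec q i - vec phat i
  rw [Finset.sum_sub_distrib (s := Finset.univ), sum_vec, sum_vec] at h0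
  have h1 := Finset.sum_add_sum_compl S fun i => |vec q i - vec phat i|
  have h2 : ∑ i ∈ S, |vec q i - vec phat i| = ∑ i ∈ S, (vec q i - vec phat i) :=
    Finset.sum_congr rfl fun i hi =>
      abs_of_pos (sub_pos.2 ((mem_scheffeSet q phat i).1 hi))
  have h3 : ∑ i ∈ Sᶜ, |vec q i - vec phat i| = - ∑ i ∈ Sᶜ, (vec q i - vec phat i) := by
    rw [← Finset.sum_neg_distrib]
    refine Finset.sum_congr rfl fun i hi => abs_of_nonpos ?_
    have := (mem_scheffeSet q phat i).not.1 (Finset.mem_compl.1 hi)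
    linarith
  linarith

theorem tv_eq_half (p q : PMF (Fin n)) : tv p q = (∑ i, |vec p i - vec q i|) / 2 := by
  refine le_antisymm (ciSup_le fun S => abs_mass_sub_le_half p q S) ?_
  rw [← mass_scheffeSet_sub p q]
  exact (le_abs_self _).trans (abs_mass_sub_le_tv p q _)

theorem mass_scheffeSet_sub_eq_tv (q phat : PMF (Fin n)) :
    mass q (scheffeSet q phat) - mass phat (scheffeSet q phat) = tv q phat := by
  rw [mass_scheffeSet_sub, tv_eq_half]

theorem prob_eq_iidExp {O : Type} (A : SampleAlg n O) (p : PMF (Fin n)) (o : O) :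
    A.prob p o = iidExp (vec p) fun x => (A.out x o).toReal := rfl

theorem toReal_apply_nonneg {O : Type*} (p : PMF O) (o : O) : 0 ≤ (p o).toReal :=
  ENNReal.toReal_nonneg

theorem toReal_apply_le_one {O : Type*} (p : PMF O) (o : O) : (p o).toReal ≤ 1 :=
  ENNReal.toReal_le_of_le_ofReal zero_le_one (by simpa using p.coe_le_one o)

theorem standardRate_eq {ε : ℝ} (n : ℕ) (hε : 0 < ε) :
    standardRate n ε = ENNReal.ofReal (√(n : ℝ) / ε ^ 2) := by
  rw [standardRate, ENNReal.ofReal_div_of_pos (by positivity)]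

end Vectors

/-! ### A standard identity tester -/

/-- The centred indicator of `i`. -/
def centred {n : ℕ} (q : Fin n → ℝ) (i y : Fin n) : ℝ := (if y = i then 1 else 0) - q i

/-- The weighted inner product of the centred counts of two batches of `m` samples. -/
def pairStat {n : ℕ} (m : ℕ) (q w : Fin n → ℝ) (x : Fin (m + m) → Fin n) : ℝ :=
  ∑ i, (w i)⁻¹ * ((∑ j, centred q i (x (Fin.castAdd m j))) *
    ∑ j, centred q i (x (Fin.natAdd m j)))

section PairStat

variable {n : ℕ} {p : Fin n → ℝ}

theorem sum_mul_centred (hp : ∑ i, p i = 1) (q : Fin n → ℝ) (i : Fin n) :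
    ∑ y, p y * centred q i y = p i - q i := by
  simp [centred, mul_sub, Finset.sum_sub_distrib, ← Finset.sum_mul, hp]

theorem sum_mul_centred_mul (hp : ∑ i, p i = 1) (q : Fin n → ℝ) (i l : Fin n) :
    ∑ y, p y * (centred q i y * centred q l y) - (p i - q i) * (p l - q l) =
      (if i = l then p i else 0) - p i * p l := by
  have : ∀ y, p y * (centred q i y * centred q l y) =
      p y * (if y = i then (if y = l then 1 else 0) else 0) -
        q l * (p y * if y = i then 1 else 0) - q i * (p y * centred q l y) := by
    intro y
    unfold centred
    split_ifs <;> ring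
  simp only [this, Finset.sum_sub_distrib, ← Finset.mul_sum, sum_mul_centred hp]
  simp only [mul_ite, mul_one, mul_zero, Finset.sum_ite_eq', Finset.mem_univ, if_true]
  ring

theorem iidExp_pairStat (hp : ∑ i, p i = 1) (m : ℕ) (q w : Fin n → ℝ) :
    iidExp p (pairStat m q w) = m ^ 2 * ∑ i, (p i - q i) ^ 2 / w i := by
  unfold pairStat
  rw [iidExp_sum, Finset.mul_sum]
  refine Finset.sum_congr rfl fun i _ => ?_
  rw [iidExp_const_mul]
  rw [iidExp_append m m p (fun x => ∑ j, centred q i (x j)) (fun x => ∑ j, centred q i (x j)),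
    iidExp_sum_coord hp, sum_mul_centred hp, Fintype.card_fin]
  ring

/-- The two batches are independent with the same law, so each mixed second moment of the centred
counts appears squared. -/
theorem iidExp_pairStat_sq (hp : ∑ i, p i = 1) (m : ℕ) (q w : Fin n → ℝ) :
    iidExp p (fun x => pairStat m q w x ^ 2) =
      ∑ i, ∑ l, (w i)⁻¹ * (w l)⁻¹ * (m * ((if i = l then p i else 0) - p i * p l) +
        (m : ℝ) ^ 2 * ((p i - q i) * (p l - q l))) ^ 2 := by
  have e : ∀ x : Fin (m + m) → Fin n, pairStat m q w x ^ 2 = ∑ i, ∑ l, ((w i)⁻¹ * (w l)⁻¹) *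
      (((∑ j, centred q i (x (Fin.castAdd m j))) * ∑ j, centred q l (x (Fin.castAdd m j))) *
        ((∑ j, centred q i (x (Fin.natAdd m j))) * ∑ j, centred q l (x (Fin.natAdd m j)))) := by
    intro x
    rw [pairStat, sq, Finset.sum_mul_sum]
    exact Finset.sum_congr rfl fun i _ => Finset.sum_congr rfl fun l _ => by ring
  simp only [e, iidExp_sum]
  refine Finset.sum_congr rfl fun i _ => Finset.sum_congr rfl fun l _ => ?_
  rw [iidExp_const_mul,
    iidExp_append m m p (fun x => (∑ j, centred q i (x j)) * ∑ j, centred q l (x j))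
      (fun x => (∑ j, centred q i (x j)) * ∑ j, centred q l (x j)),
    iidExp_sum_mul_sum hp, sum_mul_centred hp, sum_mul_centred hp, sum_mul_centred_mul hp,
    Fintype.card_fin]
  ring

/-- This is the quadratic form of the multinomial covariance `diag p - p pᵀ` at the vector `b / w`;
the rank-one part only subtracts a square. -/
theorem sum_cov_mul_le (p b w : Fin n → ℝ) :
    ∑ i, ∑ l, (w i)⁻¹ * (w l)⁻¹ * (((if i = l then p i else 0) - p i * p l) * (b i * b l)) ≤
      ∑ i, p i * b i ^ 2 / w i ^ 2 := by
  have e : ∑ i, ∑ l, (w i)⁻¹ * (w l)⁻¹ * (((if i = l then p i else 0) - p i * p l) * (b i * b l)) =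
      ∑ i, p i * b i ^ 2 / w i ^ 2 - (∑ i, p i * b i / w i) ^ 2 := by
    rw [sq (∑ i, p i * b i / w i), Finset.sum_mul_sum, ← Finset.sum_sub_distrib]
    refine Finset.sum_congr rfl fun i _ => ?_
    have : p i * b i ^ 2 / w i ^ 2 =
        ∑ l, if i = l then (w i)⁻¹ * (w l)⁻¹ * (p i * (b i * b l)) else 0 := by
      rw [Finset.sum_ite_eq]
      simp only [Finset.mem_univ, if_true]
      ring
    rw [this, ← Finset.sum_sub_distrib]
    refine Finset.sum_congr rfl fun l _ => ?_
    split_ifs <;> ring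
  rw [e]
  linarith [sq_nonneg (∑ i, p i * b i / w i)]

/-- Expanding leaves the cross term `-2 * ∑ p ^ 3 / w ^ 2` and the square `(∑ p ^ 2 / w) ^ 2`.
Cauchy–Schwarz with `∑ p = 1` bounds the square by `∑ p ^ 3 / w ^ 2`, so the cross term absorbs it.
-/
theorem sum_cov_sq_le (hp0 : ∀ i, 0 ≤ p i) (hp : ∑ i, p i = 1) (w : Fin n → ℝ) :
    ∑ i, ∑ l, (w i)⁻¹ * (w l)⁻¹ * ((if i = l then p i else 0) - p i * p l) ^ 2 ≤
      ∑ i, p i ^ 2 / w i ^ 2 := by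
  have e : ∑ i, ∑ l, (w i)⁻¹ * (w l)⁻¹ * ((if i = l then p i else 0) - p i * p l) ^ 2 =
      ∑ i, p i ^ 2 / w i ^ 2 - 2 * ∑ i, p i ^ 3 / w i ^ 2 + (∑ i, p i ^ 2 / w i) ^ 2 := by
    rw [sq (∑ i, p i ^ 2 / w i), Finset.sum_mul_sum, Finset.mul_sum, ← Finset.sum_sub_distrib,
      ← Finset.sum_add_distrib]
    refine Finset.sum_congr rfl fun i _ => ?_
    have : p i ^ 2 / w i ^ 2 - 2 * (p i ^ 3 / w i ^ 2) =
        ∑ l, if i = l then (w i)⁻¹ * (w l)⁻¹ * (p i ^ 2 - 2 * p i ^ 2 * p l) else 0 := by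
      rw [Finset.sum_ite_eq]
      simp only [Finset.mem_univ, if_true]
      ring
    rw [this, ← Finset.sum_add_distrib]
    refine Finset.sum_congr rfl fun l _ => ?_
    split_ifs with h
    · subst h; ring
    · ring
  have cs : (∑ i, p i ^ 2 / w i) ^ 2 ≤ (∑ i, p i) * ∑ i, p i ^ 3 / w i ^ 2 :=
    Finset.sum_sq_le_sum_mul_sum_of_sq_le_mul _ (fun i _ => hp0 i)
      (fun i _ => div_nonneg (pow_nonneg (hp0 i) 3) (sq_nonneg _))
      (fun i _ => le_of_eq (by ring))
  have h3 : 0 ≤ ∑ i, p i ^ 3 / w i ^ 2 :=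
    Finset.sum_nonneg fun i _ => div_nonneg (pow_nonneg (hp0 i) 3) (sq_nonneg _)
  rw [hp, one_mul] at cs
  rw [e]
  linarith

theorem variance_pairStat_le (hp0 : ∀ i, 0 ≤ p i) (hp : ∑ i, p i = 1) (m : ℕ)
    (q w : Fin n → ℝ) :
    iidExp p (fun x => (pairStat m q w x - m ^ 2 * ∑ i, (p i - q i) ^ 2 / w i) ^ 2) ≤
      m ^ 2 * ∑ i, p i ^ 2 / w i ^ 2 + 2 * m ^ 3 * ∑ i, p i * (p i - q i) ^ 2 / w i ^ 2 := by
  rw [iidExp_sq_sub hp _ _ (iidExp_pairStat hp m q w), iidExp_pairStat_sq hp]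
  -- Square of covariance plus product of means: the last of the three terms is exactly the squared
  -- mean of the statistic and cancels.
  have e : ∑ i, ∑ l, (w i)⁻¹ * (w l)⁻¹ * (m * ((if i = l then p i else 0) - p i * p l) +
        (m : ℝ) ^ 2 * ((p i - q i) * (p l - q l))) ^ 2 =
      m ^ 2 * (∑ i, ∑ l, (w i)⁻¹ * (w l)⁻¹ * ((if i = l then p i else 0) - p i * p l) ^ 2) +
      2 * m ^ 3 * (∑ i, ∑ l, (w i)⁻¹ * (w l)⁻¹ *
        (((if i = l then p i else 0) - p i * p l) * ((p i - q i) * (p l - q l)))) +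
      (m ^ 2 * ∑ i, (p i - q i) ^ 2 / w i) ^ 2 := by
    rw [mul_pow, sq (∑ i, (p i - q i) ^ 2 / w i), Finset.sum_mul_sum]
    simp only [Finset.mul_sum, ← Finset.sum_add_distrib]
    exact Finset.sum_congr rfl fun i _ => Finset.sum_congr rfl fun l _ => by ring
  rw [e]
  have h1 := mul_le_mul_of_nonneg_left (sum_cov_sq_le hp0 hp w)
    (by positivity : (0 : ℝ) ≤ m ^ 2)
  have h2 := mul_le_mul_of_nonneg_left (sum_cov_mul_le p (fun i => p i - q i) w)
    (by positivity : (0 : ℝ) ≤ 2 * m ^ 3)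
  linarith

end PairStat

/-! ### Chi-square type distance with mixed weights -/

section MixedWeights

variable {n : ℕ} {p q : Fin n → ℝ}

/-- The average of a probability vector and the uniform one. -/
def mixedWeight {n : ℕ} (q : Fin n → ℝ) (i : Fin n) : ℝ := (q i + 1 / n) / 2

theorem mixedWeight_pos (hq0 : ∀ i, 0 ≤ q i) (i : Fin n) : 0 < mixedWeight q i := by
  have : 0 < (n : ℝ) := Nat.cast_pos.2 i.pos
  have := hq0 i
  unfold mixedWeight
  positivity

theorem le_two_mul_mixedWeight (i : Fin n) : q i ≤ 2 * mixedWeight q i := by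
  have : 0 ≤ 1 / (n : ℝ) := by positivity
  unfold mixedWeight
  linarith

theorem one_le_mul_mixedWeight (hq0 : ∀ i, 0 ≤ q i) (i : Fin n) :
    1 ≤ 2 * n * mixedWeight q i := by
  have hn : 0 < (n : ℝ) := Nat.cast_pos.2 i.pos
  have := mul_nonneg hn.le (hq0 i)
  unfold mixedWeight
  have e : 2 * n * ((q i + 1 / n) / 2) = n * q i + 1 := by field_simp
  rw [e]; linarith

theorem sum_mixedWeight (hn : 0 < n) (hq : ∑ i, q i = 1) : ∑ i, mixedWeight q i = 1 := by
  have : (n : ℝ) ≠ 0 := Nat.cast_ne_zero.2 hn.ne'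
  unfold mixedWeight
  rw [← Finset.sum_div, Finset.sum_add_distrib, hq]
  simp [this]

/-- The weighted squared distance. -/
def chiDist {n : ℕ} (p q : Fin n → ℝ) : ℝ := ∑ i, (p i - q i) ^ 2 / mixedWeight q i

theorem sq_sum_abs_le_chiDist (hn : 0 < n) (hq0 : ∀ i, 0 ≤ q i) (hq : ∑ i, q i = 1) :
    (∑ i, |p i - q i|) ^ 2 ≤ chiDist p q := by
  have := Finset.sq_sum_div_le_sum_sq_div Finset.univ (fun i => |p i - q i|)
    (g := mixedWeight q) fun i _ => mixedWeight_pos hq0 i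
  rw [sum_mixedWeight hn hq, div_one] at this
  simp only [sq_abs] at this
  exact this

theorem term_le_chiDist (hq0 : ∀ i, 0 ≤ q i) (i : Fin n) :
    (p i - q i) ^ 2 / mixedWeight q i ≤ chiDist p q :=
  Finset.single_le_sum (f := fun i => (p i - q i) ^ 2 / mixedWeight q i)
    (fun j _ => div_nonneg (sq_nonneg _) (mixedWeight_pos hq0 j).le) (Finset.mem_univ i)

theorem chiDist_nonneg (hq0 : ∀ i, 0 ≤ q i) : 0 ≤ chiDist p q :=
  Finset.sum_nonneg fun j _ => div_nonneg (sq_nonneg _) (mixedWeight_pos hq0 j).le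

theorem sq_div_sq_le (hq0 : ∀ i, 0 ≤ q i) (i : Fin n) :
    (p i - q i) ^ 2 / mixedWeight q i ^ 2 ≤ 2 * n * ((p i - q i) ^ 2 / mixedWeight q i) := by
  have hw := mixedWeight_pos hq0 i
  have h := mul_le_mul_of_nonneg_left (one_le_mul_mixedWeight hq0 i) (sq_nonneg (p i - q i))
  rw [div_le_iff₀ (by positivity)]
  have e : 2 * n * ((p i - q i) ^ 2 / mixedWeight q i) * mixedWeight q i ^ 2 =
      (p i - q i) ^ 2 * (2 * n * mixedWeight q i) := by field_simp
  rw [e]; linarith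

theorem sum_sq_div_le (hq0 : ∀ i, 0 ≤ q i) :
    ∑ i, p i ^ 2 / mixedWeight q i ^ 2 ≤ 4 * n * chiDist p q + 8 * n := by
  have : ∀ i, p i ^ 2 / mixedWeight q i ^ 2 ≤
      4 * n * ((p i - q i) ^ 2 / mixedWeight q i) + 8 := by
    intro i
    have hw := mixedWeight_pos hq0 i
    have h1 := sq_div_sq_le (p := p) hq0 i
    have h2 : q i ^ 2 / mixedWeight q i ^ 2 ≤ 4 := by
      rw [div_le_iff₀ (by positivity)]
      have := pow_le_pow_left₀ (hq0 i) (le_two_mul_mixedWeight i) 2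
      linarith
    have h3 : p i ^ 2 / mixedWeight q i ^ 2 ≤
        2 * ((p i - q i) ^ 2 / mixedWeight q i ^ 2) + 2 * (q i ^ 2 / mixedWeight q i ^ 2) := by
      rw [← mul_div_assoc, ← mul_div_assoc, ← add_div]
      gcongr
      nlinarith [sq_nonneg (p i - q i - q i)]
    linarith
  refine (Finset.sum_le_sum fun i _ => this i).trans (le_of_eq ?_)
  rw [Finset.sum_add_distrib, ← Finset.mul_sum, chiDist]
  simp
  ring

/-- The extra factor `p i / w i` is at most `2 + |p i - q i| / w i`, and a single term of `chiDist`
together with `w i ≥ 1 / (2n)` bounds the last ratio by `√(2n * chiDist p q)`. -/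
theorem sum_mul_sq_div_le (hq0 : ∀ i, 0 ≤ q i) :
    ∑ i, p i * (p i - q i) ^ 2 / mixedWeight q i ^ 2 ≤
      (2 + 2 * (√(n : ℝ) * √(chiDist p q))) * chiDist p q := by
  set c := 2 + 2 * (√(n : ℝ) * √(chiDist p q)) with hc
  rw [chiDist, Finset.mul_sum]
  refine Finset.sum_le_sum fun i _ => ?_
  have hw := mixedWeight_pos hq0 i
  have hA := chiDist_nonneg (p := p) hq0
  have h1 : |p i - q i| / mixedWeight q i ≤ 2 * (√(n : ℝ) * √(chiDist p q)) := by
    refine abs_le_of_sq_le_sq' ?_ (by positivity) |>.2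
    rw [div_pow, sq_abs, mul_pow, mul_pow, Real.sq_sqrt (by positivity), Real.sq_sqrt hA]
    refine (sq_div_sq_le hq0 i).trans ?_
    have := mul_le_mul_of_nonneg_left (term_le_chiDist (p := p) hq0 i)
      (by positivity : (0 : ℝ) ≤ 2 * n)
    have h0 : 0 ≤ (n : ℝ) * chiDist p q := by positivity
    linarith
  have h2 : p i / mixedWeight q i ≤ 2 + |p i - q i| / mixedWeight q i := by
    rw [div_le_iff₀ hw, add_mul, div_mul_cancel₀ _ hw.ne']
    linarith [le_abs_self (p i - q i), le_two_mul_mixedWeight (q := q) i]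
  have e : p i * (p i - q i) ^ 2 / mixedWeight q i ^ 2 =
      p i / mixedWeight q i * ((p i - q i) ^ 2 / mixedWeight q i) := by field_simp
  rw [e]
  exact mul_le_mul_of_nonneg_right (by linarith) (by positivity)

end MixedWeights

/-! ### Sample size, threshold and error of the standard tester -/

/-- The number of samples in each of the two batches. -/
def batchSize (n : ℕ) (ε : ℝ) : ℕ := ⌈400 * (√(n : ℝ) / ε ^ 2)⌉₊

open scoped Classical in
/-- The tester that thresholds `pairStat` with mixed weights. -/
def pairTester (n : ℕ) (ε : ℝ) (q : PMF (Fin n)) : SampleAlg n Verdict where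
  samples := batchSize n ε + batchSize n ε
  out x :=
    if pairStat (batchSize n ε) (vec q) (mixedWeight (vec q)) x ≤
        2 * ε ^ 2 * (batchSize n ε : ℝ) ^ 2 then
      PMF.pure .accept
    else
      PMF.pure .reject

/-- The Chebyshev condition for a far `p`, with `r = √n`, `s = √(chiDist p q)` and `M` the batch
size, after division by `M ^ 2 / 4`. The facts `b1` to `b4` each dominate one of the four monomials
on the left. -/
theorem tester_numeric {r s ε M : ℝ} (hr : 1 ≤ r) (hε : 0 < ε) (hε1 : ε ≤ 1) (hs : 2 * ε ≤ s)
    (hM : 400 * r ≤ M * ε ^ 2) :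
    4 * (4 * r ^ 2 * s ^ 2 + 8 * r ^ 2) + 8 * M * ((2 + 2 * (r * s)) * s ^ 2) ≤
      1 / 20 * (M * s ^ 2) ^ 2 := by
  have hM0 : 0 < M := by
    by_contra h
    have := mul_nonpos_of_nonpos_of_nonneg (not_lt.1 h) (sq_nonneg ε)
    linarith
  have hs0 : 0 < s := by linarith
  have a0 : 4 * ε ^ 2 ≤ s ^ 2 := by nlinarith
  have a1 : 1600 * r ≤ M * s ^ 2 := by
    have := mul_le_mul_of_nonneg_left a0 hM0.le
    linarith
  have a2 : 800 * r ≤ M * s := by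
    have h1 : 2 * ε ^ 2 ≤ s := by nlinarith
    have := mul_le_mul_of_nonneg_left h1 hM0.le
    linarith
  have b1 : (1600 * r) ^ 2 ≤ (M * s ^ 2) ^ 2 := pow_le_pow_left₀ (by positivity) a1 2
  have b2 : (800 * r) ^ 2 * s ^ 2 ≤ (M * s ^ 2) ^ 2 := by
    have := mul_le_mul_of_nonneg_right (pow_le_pow_left₀ (by positivity) a2 2) (sq_nonneg s)
    calc _ ≤ _ := this
      _ = _ := by ring
  have b3 : 1600 * (M * s ^ 2) ≤ (M * s ^ 2) ^ 2 := by
    rw [sq (M * s ^ 2)]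
    exact mul_le_mul_of_nonneg_right (by linarith) (by positivity)
  have b4 : 800 * r * (M * s ^ 3) ≤ (M * s ^ 2) ^ 2 := by
    have := mul_le_mul_of_nonneg_right a2 (by positivity : 0 ≤ M * s ^ 3)
    calc _ ≤ _ := this
      _ = _ := by ring
  nlinarith

theorem one_le_rate {n : ℕ} (hn : 0 < n) {ε : ℝ} (hε : 0 < ε) (hε1 : ε ≤ 1) :
    1 ≤ √(n : ℝ) / ε ^ 2 := by
  have h1 : (1 : ℝ) ≤ √(n : ℝ) := Real.one_le_sqrt.2 (Nat.one_le_cast.2 hn)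
  rw [le_div_iff₀ (by positivity)]
  nlinarith

theorem pos_of_pmf {n : ℕ} (q : PMF (Fin n)) : 0 < n := by
  rcases Nat.eq_zero_or_pos n with h | h
  · subst h
    have := sum_vec q
    simp at this
  · exact h

theorem pairTester_isStandardIdentityTester (n : ℕ) {ε : ℝ} (hε : 0 < ε) (hε1 : ε ≤ 1) :
    IsStandardIdentityTester ε (1 / 20) (pairTester n ε) := by
  intro q p
  have hn := pos_of_pmf q
  set m := batchSize n ε with hm
  have hmε : 400 * √(n : ℝ) ≤ m * ε ^ 2 := by
    have : 400 * (√(n : ℝ) / ε ^ 2) ≤ m := Nat.le_ceil _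
    rwa [← mul_div_assoc, div_le_iff₀ (by positivity)] at this
  have hr : (1 : ℝ) ≤ √(n : ℝ) := Real.one_le_sqrt.2 (Nat.one_le_cast.2 hn)
  have hrr : √(n : ℝ) ^ 2 = n := Real.sq_sqrt (by positivity)
  have hm0 : (0 : ℝ) < m := by
    by_contra h
    have := mul_nonpos_of_nonpos_of_nonneg (not_lt.1 h) (sq_nonneg ε)
    linarith
  have hV := variance_pairStat_le (vec_nonneg p) (sum_vec p) m (vec q) (mixedWeight (vec q))
  have hV2 := sum_sq_div_le (p := vec p) (vec_nonneg q)
  have hV1 := sum_mul_sq_div_le (p := vec p) (vec_nonneg q)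
  constructor
  · rintro rfl
    rw [prob_eq_iidExp]
    refine (iidExp_chebyshev (vec_nonneg p) (pairStat m (vec p) (mixedWeight (vec p))) 0
      (t := 2 * ε ^ 2 * (m : ℝ) ^ 2) (by positivity) _ (fun x => toReal_apply_le_one _ _)
      ?_).trans ?_
    · intro x hx
      rw [sub_zero] at hx
      have hx := (le_abs_self _).trans hx.le
      simp only [pairTester]
      rw [if_pos hx]
      simp
    -- For `p = q` the distance vanishes, so the variance is at most `8 * n * m ^ 2`.
    · simp only [sub_self, ne_eq, OfNat.ofNat_ne_zero, not_false_eq_true, zero_pow, zero_div,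
        mul_zero, Finset.sum_const_zero, chiDist, add_zero, zero_add] at hV hV2
      rw [div_le_iff₀ (by positivity)]
      refine hV.trans ((mul_le_mul_of_nonneg_left hV2 (by positivity)).trans ?_)
      have h1 : (400 * √(n : ℝ)) ^ 2 ≤ (m * ε ^ 2) ^ 2 := pow_le_pow_left₀ (by positivity) hmε 2
      rw [mul_pow, hrr] at h1
      have h2 := mul_le_mul_of_nonneg_left h1 (by positivity : (0 : ℝ) ≤ m ^ 2)
      have h3 : 0 ≤ (m : ℝ) ^ 2 * n := by positivity
      nlinarith
  · intro hfar
    have hA := chiDist_nonneg (p := vec p) (vec_nonneg q)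
    have hA4 : 4 * ε ^ 2 ≤ chiDist (vec p) (vec q) := by
      refine le_trans ?_ (sq_sum_abs_le_chiDist hn (vec_nonneg q) (sum_vec q))
      have h2 : 2 * ε ≤ ∑ i, |vec p i - vec q i| := by
        rw [tv_eq_half] at hfar; linarith
      calc 4 * ε ^ 2 = (2 * ε) ^ 2 := by ring
        _ ≤ _ := pow_le_pow_left₀ (by positivity) h2 2
    set A := chiDist (vec p) (vec q) with hAdef
    have hA0 : 0 < A := by nlinarith [sq_pos_of_pos hε]
    have hss : √A ^ 2 = A := Real.sq_sqrt hA
    have hs : 2 * ε ≤ √A := Real.le_sqrt_of_sq_le (by linarith)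
    rw [prob_eq_iidExp]
    -- Since `A ≥ 4 * ε ^ 2`, the acceptance threshold is at most half the mean `m ^ 2 * A`;
    -- accepting therefore forces a deviation of at least half the mean.
    refine (iidExp_chebyshev (vec_nonneg p) (pairStat m (vec q) (mixedWeight (vec q)))
      (m ^ 2 * A) (t := (m : ℝ) ^ 2 * A / 2) (by positivity) _
      (fun x => toReal_apply_le_one _ _) ?_).trans ?_
    · intro x hx
      have hx := (abs_lt.1 hx).1
      have h1 := mul_le_mul_of_nonneg_left hA4 (by positivity : (0 : ℝ) ≤ m ^ 2)
      simp only [pairTester]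
      rw [if_neg]
      · simp
      · rw [not_le]
        change 2 * ε ^ 2 * (m : ℝ) ^ 2 < pairStat m (vec q) (mixedWeight (vec q)) x
        linarith
    · rw [div_le_iff₀ (by positivity)]
      refine (show _ ≤ _ from hV).trans ?_
      have num := tester_numeric hr hε hε1 hs hmε
      rw [hrr, hss] at num
      have h1 := mul_le_mul_of_nonneg_left hV2 (by positivity : (0 : ℝ) ≤ m ^ 2)
      have h2 := mul_le_mul_of_nonneg_left hV1 (by positivity : (0 : ℝ) ≤ 2 * m ^ 3)
      have h3 := mul_le_mul_of_nonneg_left num (by positivity : (0 : ℝ) ≤ (m : ℝ) ^ 2 / 4)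
      refine (add_le_add h1 h2).trans (le_trans (le_of_eq ?_) (h3.trans (le_of_eq ?_))) <;> ring

theorem pairTester_samples_le (n : ℕ) {ε : ℝ} (hε : 0 < ε) (hε1 : ε ≤ 1) (q : PMF (Fin n)) :
    ((pairTester n ε q).samples : ℝ≥0∞) ≤ (802 : ℝ≥0) * standardRate n ε := by
  have h1 := one_le_rate (pos_of_pmf q) hε hε1
  have h2 : (batchSize n ε : ℝ) ≤ 400 * (√(n : ℝ) / ε ^ 2) + 1 :=
    (Nat.ceil_lt_add_one (by positivity)).le
  rw [standardRate_eq n hε, ← ENNReal.ofReal_natCast, ← ENNReal.ofReal_coe_nnreal,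
    ← ENNReal.ofReal_mul (by positivity)]
  refine ENNReal.ofReal_le_ofReal ?_
  simp only [pairTester, Nat.cast_add, NNReal.coe_ofNat]
  linarith

/-! ### The augmented tester -/

/-! ### The Scheffé-set branch -/

section Scheffe

variable {n : ℕ}

theorem variance_sampleFraction_le (p : PMF (Fin n)) (S : Finset (Fin n)) {m : ℕ} (hm : 0 < m) :
    iidExp (vec p) (fun x : Fin m → Fin n => (sampleFraction S x - mass p S) ^ 2) ≤
      1 / (4 * m) := by
  have hm' : (m : ℝ) ≠ 0 := Nat.cast_ne_zero.2 hm.ne'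
  set u : Fin n → ℝ := fun i => if i ∈ S then 1 else 0 with hu
  have hP : ∑ i, vec p i * u i = mass p S := by
    simp [hu, mass_eq]
  have hP2 : ∑ i, vec p i * (u i * u i) = mass p S := by
    rw [← hP]
    exact Finset.sum_congr rfl fun i _ => by simp only [hu]; split_ifs <;> simp
  have hσ : ∀ x : Fin m → Fin n, sampleFraction S x = (m : ℝ)⁻¹ * ∑ j, u (x j) := by
    intro x
    rw [sampleFraction, hu, Finset.sum_boole, div_eq_inv_mul]
  have hE : iidExp (vec p) (fun x : Fin m → Fin n => sampleFraction S x) = mass p S := by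
    simp only [hσ]
    rw [iidExp_const_mul, iidExp_sum_coord (sum_vec p), hP, Fintype.card_fin,
      inv_mul_cancel_left₀ hm']
  rw [iidExp_sq_sub (sum_vec p) _ _ hE]
  have e : (fun x : Fin m → Fin n => sampleFraction S x ^ 2) =
      fun x => ((m : ℝ)⁻¹) ^ 2 * ((∑ j, u (x j)) * ∑ j, u (x j)) := by
    funext x; rw [hσ]; ring
  rw [e, iidExp_const_mul, iidExp_sum_mul_sum (sum_vec p), hP, hP2, Fintype.card_fin]
  have e2 : ((m : ℝ)⁻¹) ^ 2 * (m * (mass p S - mass p S * mass p S) +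
      (m : ℝ) ^ 2 * (mass p S * mass p S)) - mass p S ^ 2 =
      (mass p S - mass p S ^ 2) / m := by
    field_simp; ring
  rw [e2, one_div, mul_inv, ← div_eq_mul_inv]
  gcongr
  nlinarith [sq_nonneg (mass p S - 1 / 2)]

/-- The variance is at most `1 / (4 * m)`, and `1 / (4 * m) ≤ (1 / 20) * (g / 4) ^ 2` means `m ≥ 80
/ g ^ 2`; hence the constant 80. -/
theorem scheffe_deviation_le {K g : ℝ} (hK : 80 ≤ K) (hg : 0 < g) (p : PMF (Fin n))
    (S : Finset (Fin n)) (φ : (Fin ⌈K / g ^ 2⌉₊ → Fin n) → ℝ) (h1 : ∀ x, φ x ≤ 1)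
    (h0 : ∀ x, |sampleFraction S x - mass p S| < g / 4 → φ x ≤ 0) :
    iidExp (vec p) φ ≤ 1 / 20 := by
  have hKm : K / g ^ 2 ≤ (⌈K / g ^ 2⌉₊ : ℝ) := Nat.le_ceil _
  have hm : 0 < ⌈K / g ^ 2⌉₊ := Nat.ceil_pos.2 (div_pos (by linarith) (by positivity))
  have hm' : (0 : ℝ) < (⌈K / g ^ 2⌉₊ : ℝ) := Nat.cast_pos.2 hm
  refine (iidExp_chebyshev (vec_nonneg p) (fun x => sampleFraction S x) (mass p S)
    (t := g / 4) (by positivity) φ h1 h0).trans ?_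
  rw [div_le_iff₀ (by positivity)]
  refine (variance_sampleFraction_le p S hm).trans ?_
  rw [div_le_iff₀ (by positivity)] at hKm ⊢
  linarith

theorem scheffeBranch_isAugmentedFor {K α ε : ℝ} (hK : 80 ≤ K) (q phat : PMF (Fin n))
    (hd : α < tv q phat) : IsAugmentedFor α ε (1 / 10) q phat (scheffeBranch K α q phat) := by
  set g := tv q phat - α with hg
  have hg0 : 0 < g := sub_pos.2 hd
  set S := scheffeSet q phat with hS
  have hgap : mass q S - mass phat S = tv q phat := mass_scheffeSet_sub_eq_tv q phat
  intro p
  refine ⟨fun hp => ?_, fun hp => ?_, fun _ => ?_⟩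
  · rw [prob_eq_iidExp, show (1 / 10 : ℝ) / 2 = 1 / 20 by norm_num]
    refine scheffe_deviation_le hK hg0 p S _ (fun x => toReal_apply_le_one _ _) fun x hx => ?_
    -- Here `p(S) ≤ phat(S) + α = q(S) - g`, so an estimate within `g / 4` of `p(S)` stays more than
    -- `3 * g / 4` below `q(S)`.
    have hp' := (abs_le.1 ((abs_mass_sub_le_tv p phat S).trans hp)).2
    have hx' := (abs_lt.1 hx).2
    simp only [scheffeBranch]
    rw [if_pos]
    · simp
    · refine lt_of_lt_of_le ?_ (le_abs_self _)
      change g / 4 < mass q S - sampleFraction S x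
      linarith
  · subst hp
    rw [prob_eq_iidExp, show (1 / 10 : ℝ) / 2 = 1 / 20 by norm_num]
    refine scheffe_deviation_le hK hg0 p S _ (fun x => toReal_apply_le_one _ _) fun x hx => ?_
    simp only [scheffeBranch]
    rw [if_neg]
    · simp
    · rw [not_lt, abs_sub_comm]
      exact hx.le
  · rw [prob_eq_iidExp]
    have : ∀ x, (((scheffeBranch K α q phat).out x) Answer.accept).toReal = 0 := by
      intro x
      simp only [scheffeBranch]
      split_ifs <;> simp
    simp only [this]
    rw [iidExp_const (sum_vec p)]
    norm_num

theorem scheffeBranch_samples_le {K α : ℝ} (hK : 0 ≤ K) (hα : 0 ≤ α) (q phat : PMF (Fin n))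
    (hd : α < tv q phat) :
    ((scheffeBranch K α q phat).samples : ℝ) ≤ (K + 1) * (1 / (tv q phat - α) ^ 2) := by
  have hg0 : 0 < tv q phat - α := sub_pos.2 hd
  -- The rate is at least one because `d - α ≤ 1`; this absorbs the rounding up of the sample size.
  have h1 : (1 : ℝ) ≤ 1 / (tv q phat - α) ^ 2 := by
    rw [le_div_iff₀ (by positivity), one_mul]
    exact pow_le_one₀ hg0.le (by linarith [tv_le_one q phat])
  have h2 : (⌈K / (tv q phat - α) ^ 2⌉₊ : ℝ) < K / (tv q phat - α) ^ 2 + 1 :=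
    Nat.ceil_lt_add_one (by positivity)
  have h3 : K / (tv q phat - α) ^ 2 = K * (1 / (tv q phat - α) ^ 2) := div_eq_mul_one_div _ _
  change (⌈K / (tv q phat - α) ^ 2⌉₊ : ℝ) ≤ _
  linarith

end Scheffe

/-! ### The branch that calls the standard tester -/

section Standard

variable {n : ℕ}

theorem toAnswer_accept (P : PMF Verdict) :
    (P.map Verdict.toAnswer) .accept = P .accept := by
  classical
  rw [PMF.map_apply, tsum_eq_single Verdict.accept]
  · simp [Verdict.toAnswer]
  · rintro (_ | _) h <;> simp_all [Verdict.toAnswer]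

theorem toAnswer_reject (P : PMF Verdict) :
    (P.map Verdict.toAnswer) .reject = P .reject := by
  classical
  rw [PMF.map_apply, tsum_eq_single Verdict.reject]
  · simp [Verdict.toAnswer]
  · rintro (_ | _) h <;> simp_all [Verdict.toAnswer]

theorem toAnswer_inaccurate (P : PMF Verdict) :
    (P.map Verdict.toAnswer) .inaccurate = 0 := by
  classical
  rw [PMF.map_apply, ENNReal.tsum_eq_zero]
  rintro (_ | _) <;> simp [Verdict.toAnswer]

theorem standardBranch_isAugmentedFor {α ε : ℝ} (T : PMF (Fin n) → SampleAlg n Verdict)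
    (hT : IsStandardIdentityTester ε (1 / 20) T) (q phat : PMF (Fin n)) :
    IsAugmentedFor α ε (1 / 10) q phat (standardBranch (T q)) := by
  intro p
  rw [show (1 / 10 : ℝ) / 2 = 1 / 20 by norm_num]
  refine ⟨fun _ => ?_, fun hp => ?_, fun hp => ?_⟩
  · rw [prob_eq_iidExp]
    simp only [standardBranch, toAnswer_inaccurate, ENNReal.toReal_zero]
    rw [iidExp_const (sum_vec p)]
    norm_num
  · have := (hT q p).1 hp
    simpa only [prob_eq_iidExp, standardBranch, toAnswer_reject] using this
  · have := (hT q p).2 hp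
    simpa only [prob_eq_iidExp, standardBranch, toAnswer_accept] using this

end Standard

theorem augmentedIdentityTester_correct {n : ℕ} {K α ε : ℝ} (hK : 80 ≤ K)
    (T : PMF (Fin n) → SampleAlg n Verdict) (hT : IsStandardIdentityTester ε (1 / 20) T) :
    IsAugmentedIdentityTester α ε (1 / 10) (augmentedIdentityTester K T α ε) := by
  intro q phat
  unfold augmentedIdentityTester
  split_ifs with h
  · exact standardBranch_isAugmentedFor T hT q phat
  · exact scheffeBranch_isAugmentedFor hK q phat (not_le.1 (not_or.1 h).1)

/-! ### Sample count of the augmented tester -/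

theorem one_div_ofReal_sq {g : ℝ} (hg : 0 < g) :
    1 / ENNReal.ofReal (g ^ 2) = ENNReal.ofReal (1 / g ^ 2) := by
  rw [ENNReal.ofReal_div_of_pos (by positivity), ENNReal.ofReal_one]

theorem augmentedRate_of_le {n : ℕ} {α ε d : ℝ} (h : d ≤ α) :
    augmentedRate n α ε d = standardRate n ε := if_pos h

theorem augmentedRate_of_lt {n : ℕ} {α ε d : ℝ} (h : α < d) :
    augmentedRate n α ε d =
      min (ENNReal.ofReal (1 / (d - α) ^ 2)) (standardRate n ε) := by
  rw [augmentedRate, if_neg (not_le.2 h), one_div_ofReal_sq (sub_pos.2 h)]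

theorem augmentedIdentityTester_samples_le {n : ℕ} {K α ε : ℝ} (hK : 0 ≤ K) (hα : 0 ≤ α)
    (hε : 0 < ε) (C : ℝ≥0) (T : PMF (Fin n) → SampleAlg n Verdict)
    (hT : ∀ q, ((T q).samples : ℝ≥0∞) ≤ C * standardRate n ε) (q phat : PMF (Fin n)) :
    ((augmentedIdentityTester K T α ε q phat).samples : ℝ≥0∞) ≤
      (C + Real.toNNReal (K + 1) : ℝ≥0) * augmentedRate n α ε (tv q phat) := by
  have hC : (C : ℝ≥0∞) ≤ (C + Real.toNNReal (K + 1) : ℝ≥0) := by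
    exact_mod_cast le_self_add
  have hK' : ENNReal.ofReal (K + 1) ≤ (C + Real.toNNReal (K + 1) : ℝ≥0) := by
    rw [ENNReal.ofReal]
    exact_mod_cast le_add_self
  unfold augmentedIdentityTester
  split_ifs with h
  · have hr : augmentedRate n α ε (tv q phat) = standardRate n ε := by
      by_cases hd : tv q phat ≤ α
      · exact augmentedRate_of_le hd
      · rw [augmentedRate_of_lt (not_le.1 hd), standardRate_eq n hε]
        exact min_eq_right (ENNReal.ofReal_le_ofReal (h.resolve_left hd).le)
    rw [hr]
    exact (hT q).trans (mul_le_mul_left hC _)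
  · obtain ⟨hd, h2⟩ := not_or.1 h
    have hr : augmentedRate n α ε (tv q phat) =
        ENNReal.ofReal (1 / (tv q phat - α) ^ 2) := by
      rw [augmentedRate_of_lt (not_le.1 hd), standardRate_eq n hε]
      exact min_eq_left (ENNReal.ofReal_le_ofReal (not_lt.1 h2))
    rw [hr]
    refine le_trans ?_ (mul_le_mul_left hK' _)
    rw [← ENNReal.ofReal_mul (by linarith), ← ENNReal.ofReal_natCast]
    exact ENNReal.ofReal_le_ofReal (scheffeBranch_samples_le hK hα q phat (not_le.1 hd))

/-! ### Lower bounds -/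

/-! ### The second-moment method -/

section SecondMoment

variable {n m : ℕ}

theorem iidExp_likelihood (hn : 0 < n) (p : Fin n → ℝ) (f : (Fin m → Fin n) → ℝ) :
    iidExp p f = iidExp (fun _ => 1 / (n : ℝ)) fun x => (∏ j, n * p (x j)) * f x := by
  have hn' : (n : ℝ) ≠ 0 := Nat.cast_ne_zero.2 hn.ne'
  unfold iidExp
  refine Finset.sum_congr rfl fun x _ => ?_
  rw [← mul_assoc, ← Finset.prod_mul_distrib]
  congr 1
  exact Finset.prod_congr rfl fun j _ => by field_simp

theorem sq_iidExp_mul_le {ι κ : Type*} [Fintype ι] [DecidableEq ι] [Fintype κ] {p : κ → ℝ}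
    (hp : ∀ i, 0 ≤ p i) (f g : (ι → κ) → ℝ) :
    iidExp p (fun x => f x * g x) ^ 2 ≤
      iidExp p (fun x => f x ^ 2) * iidExp p (fun x => g x ^ 2) := by
  have h (x : ι → κ) : 0 ≤ ∏ j, p (x j) := Finset.prod_nonneg fun j _ => hp (x j)
  exact Finset.sum_sq_le_sum_mul_sum_of_sq_le_mul _
    (fun x _ => mul_nonneg (h x) (sq_nonneg _)) (fun x _ => mul_nonneg (h x) (sq_nonneg _))
    (fun x _ => le_of_eq (by ring))

/-- If the second moment of the likelihood ratio of a uniform mixture of i.i.d. laws to the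
uniform law is close to one, some member of the mixture fools a given test. -/
theorem exists_iidExp_uniform_le {Z : Type*} [Fintype Z] [Nonempty Z] (hn : 0 < n)
    (p : Z → Fin n → ℝ) (hp : ∀ z, ∑ i, p z i = 1) {η : ℝ}
    (H : ∑ z, ∑ z', (n * ∑ i, p z i * p z' i) ^ m ≤ (Fintype.card Z : ℝ) ^ 2 * (1 + η))
    (φ : (Fin m → Fin n) → ℝ) (h0 : ∀ x, 0 ≤ φ x) (h1 : ∀ x, φ x ≤ 1) :
    ∃ z, iidExp (fun _ => 1 / (n : ℝ)) φ ≤ iidExp (p z) φ + √η := by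
  have hn' : (n : ℝ) ≠ 0 := Nat.cast_ne_zero.2 hn.ne'
  set N : ℝ := (Fintype.card Z : ℝ) with hN
  have hN0 : 0 < N := Nat.cast_pos.2 Fintype.card_pos
  set u : Fin n → ℝ := fun _ => 1 / (n : ℝ) with hu
  have hu0 : ∀ i, 0 ≤ u i := fun i => by simp only [hu]; positivity
  have hu1 : ∑ i, u i = 1 := by simp [hu, hn']
  -- The likelihood ratio of the mixture to the uniform law. Its variance is at most `η`, so by
  -- Cauchy–Schwarz the average over `z` of the expectation of `φ` is within `√η` of the uniform
  -- one, and some `z` does at least as well as the average.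
  set L : (Fin m → Fin n) → ℝ := fun x => N⁻¹ * ∑ z, ∏ j, n * p z (x j) with hL
  have hLf : ∀ f : (Fin m → Fin n) → ℝ,
      iidExp u (fun x => L x * f x) = N⁻¹ * ∑ z, iidExp (p z) f := by
    intro f
    simp only [hL, mul_assoc, Finset.sum_mul, iidExp_const_mul, iidExp_sum]
    congr 1
    exact Finset.sum_congr rfl fun z _ => (iidExp_likelihood hn (p z) f).symm
  have hL1 : iidExp u L = 1 := by
    have := hLf fun _ => 1
    simp only [mul_one, iidExp_const (hp _), Finset.sum_const, Finset.card_univ,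
      nsmul_eq_mul] at this
    rw [this, inv_mul_cancel₀ hN0.ne']
  have hL2 : iidExp u (fun x => L x ^ 2) ≤ 1 + η := by
    have e : iidExp u (fun x => L x ^ 2) =
        (N⁻¹) ^ 2 * ∑ z, ∑ z', (n * ∑ i, p z i * p z' i) ^ m := by
      have : ∀ x, L x ^ 2 = (N⁻¹) ^ 2 *
          ∑ z, ∑ z', ∏ j, (n * p z (x j)) * (n * p z' (x j)) := by
        intro x
        simp only [hL]
        rw [mul_pow, sq (∑ z, _), Finset.sum_mul_sum]
        congr 1
        exact Finset.sum_congr rfl fun z _ => Finset.sum_congr rfl fun z' _ =>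
          Finset.prod_mul_distrib.symm
      simp only [this, iidExp_const_mul, iidExp_sum]
      congr 1
      refine Finset.sum_congr rfl fun z _ => Finset.sum_congr rfl fun z' _ => ?_
      -- For a fixed pair `z`, `z'` the samples are independent, which gives an `m`-th power of a
      -- one-sample inner product.
      rw [iidExp_prod u (fun _ i => (n * p z i) * (n * p z' i))]
      simp only [Finset.prod_const, Finset.card_univ, Fintype.card_fin]
      congr 1
      rw [Finset.mul_sum]
      refine Finset.sum_congr rfl fun i _ => ?_
      simp only [hu]
      field_simp
    rw [e]
    calc _ ≤ (N⁻¹) ^ 2 * (N ^ 2 * (1 + η)) := mul_le_mul_of_nonneg_left H (by positivity)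
      _ = 1 + η := by field_simp
  have hV : iidExp u (fun x => (L x - 1) ^ 2) ≤ η := by
    rw [iidExp_sq_sub hu1 _ _ hL1]; linarith
  have hη : 0 ≤ η := by
    refine le_trans ?_ hV
    have := iidExp_mono hu0 (f := fun _ : Fin m → Fin n => 0) (g := fun x => (L x - 1) ^ 2)
      fun x => sq_nonneg _
    rwa [iidExp_const hu1] at this
  have hφ2 : iidExp u (fun x => φ x ^ 2) ≤ 1 := by
    have := iidExp_mono hu0 (f := fun x => φ x ^ 2) (g := fun _ : Fin m → Fin n => 1)
      fun x => pow_le_one₀ (h0 x) (h1 x)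
    rwa [iidExp_const hu1] at this
  have hcs := sq_iidExp_mul_le hu0 (fun x => L x - 1) φ
  have hφ0 : 0 ≤ iidExp u (fun x => φ x ^ 2) := by
    have := iidExp_mono hu0 (f := fun _ : Fin m → Fin n => 0) (g := fun x => φ x ^ 2)
      fun x => sq_nonneg _
    rwa [iidExp_const hu1] at this
  have hcs' : iidExp u (fun x => (L x - 1) * φ x) ^ 2 ≤ η := by
    refine hcs.trans ?_
    calc _ ≤ η * 1 := mul_le_mul hV hφ2 hφ0 hη
      _ = η := mul_one η
  have habs := (abs_le.1 (Real.abs_le_sqrt hcs')).1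
  have hsplit : iidExp u (fun x => (L x - 1) * φ x) =
      N⁻¹ * ∑ z, iidExp (p z) φ - iidExp u φ := by
    rw [← hLf, ← iidExp_sub]
    congr 1
    funext x; ring
  rw [hsplit] at habs
  by_contra hcon
  push Not at hcon
  have hlt : ∑ z, iidExp (p z) φ < ∑ _z : Z, (iidExp u φ - √η) :=
    Finset.sum_lt_sum_of_nonempty Finset.univ_nonempty fun z _ => by linarith [hcon z]
  rw [Finset.sum_const, Finset.card_univ, nsmul_eq_mul] at hlt
  have := mul_lt_mul_of_pos_left hlt (inv_pos.2 hN0)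
  rw [inv_mul_cancel_left₀ hN0.ne'] at this
  linarith

end SecondMoment

/-! #### Balanced perturbations -/

/-- The balanced direction that adds mass on `S` and removes it from the complement. -/
def balanced {n : ℕ} (S : Finset (Fin n)) (i : Fin n) : ℝ :=
  if i ∈ S then 1 / (S.card : ℝ) else -(1 / ((n : ℝ) - S.card))

section Balanced

variable {n : ℕ} {S : Finset (Fin n)}

theorem sum_ite_mem_eq (S : Finset (Fin n)) (a b : ℝ) :
    ∑ i, (if i ∈ S then a else b) = S.card * a + ((n : ℝ) - S.card) * b := by
  have h : ((Sᶜ).card : ℝ) = (n : ℝ) - S.card := by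
    rw [Finset.card_compl, Fintype.card_fin, Nat.cast_sub (by simpa using S.card_le_univ)]
  rw [← Finset.sum_add_sum_compl S, Finset.sum_congr rfl fun i hi => if_pos hi,
    Finset.sum_congr rfl fun i hi => if_neg (Finset.mem_compl.1 hi)]
  simp [h]

theorem half_card_bounds (hn : 2 ≤ n) (hS : S.card = n / 2) :
    (n : ℝ) ≤ 3 * S.card ∧ (S.card : ℝ) ≤ (n : ℝ) / 2 ∧ 0 < (S.card : ℝ) := by
  have h1 : n ≤ 3 * S.card := by omega
  have h2 : 2 * S.card ≤ n := by omega
  have h3 : 0 < S.card := by omega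
  have h1' : (n : ℝ) ≤ 3 * S.card := by exact_mod_cast h1
  have h2' : 2 * (S.card : ℝ) ≤ n := by exact_mod_cast h2
  exact ⟨h1', by linarith, by exact_mod_cast h3⟩

theorem sum_balanced (hn : 2 ≤ n) (hS : S.card = n / 2) : ∑ i, balanced S i = 0 := by
  obtain ⟨-, h2, h3⟩ := half_card_bounds hn hS
  have h4 : (n : ℝ) - S.card ≠ 0 := by linarith
  unfold balanced
  rw [sum_ite_mem_eq]
  field_simp
  ring

theorem sum_abs_balanced (hn : 2 ≤ n) (hS : S.card = n / 2) : ∑ i, |balanced S i| = 2 := by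
  obtain ⟨-, h2, h3⟩ := half_card_bounds hn hS
  have h4 : 0 < (n : ℝ) - S.card := by linarith
  have e : ∀ i, |balanced S i| =
      if i ∈ S then 1 / (S.card : ℝ) else 1 / ((n : ℝ) - S.card) := by
    intro i
    unfold balanced
    split_ifs
    · exact abs_of_pos (by positivity)
    · rw [abs_neg]; exact abs_of_pos (by positivity)
  simp only [e]
  rw [sum_ite_mem_eq]
  field_simp
  norm_num

/-- The left side is `n / |S| + n / (n - |S|)`, and `|S| = ⌊n / 2⌋` lies between `n / 3` and `n /
2`. -/
theorem sum_sq_balanced_le (hn : 2 ≤ n) (hS : S.card = n / 2) :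
    n * ∑ i, balanced S i ^ 2 ≤ 5 := by
  obtain ⟨h1, h2, h3⟩ := half_card_bounds hn hS
  have h4 : 0 < (n : ℝ) - S.card := by linarith
  have e : ∀ i, balanced S i ^ 2 =
      if i ∈ S then (1 / (S.card : ℝ)) ^ 2 else (1 / ((n : ℝ) - S.card)) ^ 2 := by
    intro i
    unfold balanced
    split_ifs
    · rfl
    · rw [neg_sq]
  simp only [e]
  rw [sum_ite_mem_eq]
  have e2 : n * (S.card * (1 / (S.card : ℝ)) ^ 2 +
      ((n : ℝ) - S.card) * (1 / ((n : ℝ) - S.card)) ^ 2) =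
      n / S.card + n / ((n : ℝ) - S.card) := by
    field_simp
  rw [e2]
  have a : (n : ℝ) / S.card ≤ 3 := by rw [div_le_iff₀ h3]; linarith
  have b : (n : ℝ) / ((n : ℝ) - S.card) ≤ 2 := by rw [div_le_iff₀ h4]; linarith
  linarith

theorem neg_le_balanced (hn : 2 ≤ n) (hS : S.card = n / 2) (i : Fin n) :
    -(2 / (n : ℝ)) ≤ balanced S i := by
  obtain ⟨-, h2, h3⟩ := half_card_bounds hn hS
  have hn0 : 0 < (n : ℝ) := by linarith
  have h4 : 0 < (n : ℝ) - S.card := by linarith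
  unfold balanced
  split_ifs
  · have : 0 < 2 / (n : ℝ) := by positivity
    have : 0 < 1 / (S.card : ℝ) := by positivity
    linarith
  · rw [neg_le_neg_iff, div_le_div_iff₀ h4 hn0]
    linarith

/-- The distributions at total variation distance `d` from uniform along a balanced direction. -/
theorem exists_balanced_family (hn : 2 ≤ n) :
    ∃ S : Finset (Fin n), S.card = n / 2 ∧ ∀ d : ℝ, 0 ≤ d → d ≤ 1 / 2 →
      ∃ p : PMF (Fin n), vec p = fun i => 1 / (n : ℝ) + d * balanced S i := by
  obtain ⟨S, -, hS⟩ := Finset.exists_subset_card_eq (s := (Finset.univ : Finset (Fin n)))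
    (n := n / 2) (by simp; omega)
  have hn0 : 0 < (n : ℝ) := by positivity
  refine ⟨S, hS, fun d hd0 hd1 => exists_vec_eq _ (fun i => ?_) ?_⟩
  · have h := mul_le_mul_of_nonneg_left (neg_le_balanced hn hS i) hd0
    have h2 : d * (2 / (n : ℝ)) ≤ 1 / n := by
      rw [← mul_div_assoc]; gcongr; linarith
    linarith
  · rw [Finset.sum_add_distrib, ← Finset.mul_sum, sum_balanced hn hS]
    simp [hn0.ne']

theorem tv_balanced (hn : 2 ≤ n) (hS : S.card = n / 2) {p q : PMF (Fin n)} {s d : ℝ}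
    (hp : vec p = fun i => 1 / (n : ℝ) + s * balanced S i)
    (hq : vec q = fun i => 1 / (n : ℝ) + d * balanced S i) : tv p q = |s - d| := by
  rw [tv_eq_half, hp, hq]
  have : ∀ i, |1 / (n : ℝ) + s * balanced S i - (1 / (n : ℝ) + d * balanced S i)| =
      |s - d| * |balanced S i| := by
    intro i
    rw [← abs_mul]; congr 1; ring
  simp only [this]
  rw [← Finset.mul_sum, sum_abs_balanced hn hS]
  ring

theorem exp_le_one_add_two_mul {y : ℝ} (h0 : 0 ≤ y) (h1 : y ≤ 1) : Real.exp y ≤ 1 + 2 * y := by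
  have := (abs_le.1 (Real.abs_exp_sub_one_sub_id_le (abs_le.2 ⟨by linarith, h1⟩))).2
  nlinarith

/-- The mixture has one member: the second moment is at most `(1 + 5 * d ^ 2) ^ m ≤ exp (5 * m * d ^
2) ≤ 1 + 10 * m * d ^ 2`, and the hypothesis bounds this by `1 + γ ^ 2`. -/
theorem iidExp_uniform_le_balanced (hn : 2 ≤ n) (hS : S.card = n / 2) {p : PMF (Fin n)} {d : ℝ}
    (hp : vec p = fun i => 1 / (n : ℝ) + d * balanced S i) {m : ℕ} {γ : ℝ} (hγ0 : 0 ≤ γ)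
    (hγ1 : γ ≤ 1) (hm : 10 * (m * d ^ 2) ≤ γ ^ 2)
    (φ : (Fin m → Fin n) → ℝ) (h0 : ∀ x, 0 ≤ φ x) (h1 : ∀ x, φ x ≤ 1) :
    iidExp (fun _ => 1 / (n : ℝ)) φ ≤ iidExp (vec p) φ + γ := by
  have hn0 : (0 : ℝ) < n := by positivity
  have e : n * ∑ i, vec p i * vec p i = 1 + d ^ 2 * (n * ∑ i, balanced S i ^ 2) := by
    have : ∀ i, vec p i * vec p i =
        1 / (n : ℝ) ^ 2 + 2 / n * d * balanced S i + d ^ 2 * balanced S i ^ 2 := by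
      intro i; rw [hp]; ring
    simp only [this, Finset.sum_add_distrib, ← Finset.mul_sum, sum_balanced hn hS]
    simp
    field_simp
  have hd := mul_le_mul_of_nonneg_left (sum_sq_balanced_le hn hS) (sq_nonneg d)
  obtain ⟨z, hz⟩ := exists_iidExp_uniform_le (Z := Unit) (m := m) (η := γ ^ 2) (by omega)
    (fun _ => vec p) (fun _ => sum_vec p) (by
      simp only [Finset.univ_unique, Finset.sum_singleton, Fintype.card_unique, Nat.cast_one,
        one_pow, one_mul]
      have hle : n * ∑ i, vec p i * vec p i ≤ Real.exp (5 * d ^ 2) := by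
        rw [e]; linarith [Real.add_one_le_exp (5 * d ^ 2)]
      have hnn : 0 ≤ n * ∑ i, vec p i * vec p i :=
        mul_nonneg hn0.le (Finset.sum_nonneg fun i _ => mul_self_nonneg _)
      refine (pow_le_pow_left₀ hnn hle m).trans ?_
      rw [← Real.exp_nat_mul]
      have hγ2 : γ ^ 2 ≤ 1 := pow_le_one₀ hγ0 hγ1
      have := exp_le_one_add_two_mul (y := m * (5 * d ^ 2)) (by positivity) (by linarith)
      linarith) φ h0 h1
  rwa [Real.sqrt_sq hγ0] at hz

end Balanced

/-! #### Perturbations of blocks of four elements -/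

section Blocks

variable {n : ℕ}

/-- The element with index `c` in block `b`. -/
def blockElt (n : ℕ) (x : Fin (n / 4) × Fin 4) : Fin n := ⟨4 * x.1 + x.2, by omega⟩

theorem blockElt_injective (n : ℕ) : Function.Injective (blockElt n) := by
  rintro ⟨b, c⟩ ⟨b', c'⟩ h
  simp only [blockElt, Fin.mk.injEq] at h
  ext <;> simp only <;> omega

/-- The direction that concentrates each block on a chosen element. -/
def blockDir (z : Fin (n / 4) → Fin 4) : Fin n → ℝ :=
  Function.extend (blockElt n) (fun x => if z x.1 = x.2 then 3 else -1) 0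

theorem blockDir_blockElt (z : Fin (n / 4) → Fin 4) (x : Fin (n / 4) × Fin 4) :
    blockDir z (blockElt n x) = if z x.1 = x.2 then 3 else -1 :=
  (blockElt_injective n).extend_apply _ _ _

theorem blockDir_of_notMem (z : Fin (n / 4) → Fin 4) {i : Fin n}
    (h : i ∉ Set.range (blockElt n)) : blockDir z i = 0 :=
  Function.extend_apply' _ _ _ h

theorem neg_one_le_blockDir (z : Fin (n / 4) → Fin 4) (i : Fin n) : -1 ≤ blockDir z i := by
  by_cases h : i ∈ Set.range (blockElt n)
  · obtain ⟨x, rfl⟩ := h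
    rw [blockDir_blockElt]
    split_ifs <;> norm_num
  · rw [blockDir_of_notMem z h]; norm_num

/-- Each block takes the value 3 once and -1 three times whatever `z` is; `F 0 = 0` discards the at
most three elements outside all blocks. -/
theorem sum_blockDir_comp (z : Fin (n / 4) → Fin 4) (F : ℝ → ℝ) (hF : F 0 = 0) :
    ∑ i, F (blockDir z i) = (n / 4 : ℕ) * (F 3 + 3 * F (-1)) := by
  rw [← Fintype.sum_of_injective (blockElt n) (blockElt_injective n)
    (fun x => F (if z x.1 = x.2 then 3 else -1)) _
    (fun i hi => by rw [blockDir_of_notMem z hi, hF]) (fun x => by rw [blockDir_blockElt]),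
    Fintype.sum_prod_type]
  have : ∀ a : Fin 4, ∑ c, F (if a = c then 3 else -1) = F 3 + 3 * F (-1) := by
    intro a
    fin_cases a <;> simp [Fin.sum_univ_four] <;> ring
  simp [this, mul_add]

/-- A block where `z` and `z'` agree gives `9 + 1 + 1 + 1`, any other `-3 - 3 + 1 + 1`. For uniform
`z'` the mean is zero, so the first-order term of the second moment cancels. -/
theorem sum_blockDir_mul (z z' : Fin (n / 4) → Fin 4) :
    ∑ i, blockDir z i * blockDir z' i = ∑ b, if z b = z' b then 12 else -4 := by
  rw [← Fintype.sum_of_injective (blockElt n) (blockElt_injective n)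
    (fun x => (if z x.1 = x.2 then (3 : ℝ) else -1) * (if z' x.1 = x.2 then 3 else -1)) _
    (fun i hi => by rw [blockDir_of_notMem z hi, zero_mul])
    (fun x => by rw [blockDir_blockElt, blockDir_blockElt]),
    Fintype.sum_prod_type]
  have key : ∀ a a' : Fin 4, ∑ c, (if a = c then (3 : ℝ) else -1) * (if a' = c then 3 else -1) =
      if a = a' then 12 else -4 := by
    intro a a'
    have h : ∀ c : Fin 4, (if a = c then (3 : ℝ) else -1) * (if a' = c then 3 else -1) =
        (if a = c then (if a' = a then 16 else 0) else 0) - (if a = c then 4 else 0) -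
          (if a' = c then 4 else 0) + 1 := by
      intro c
      by_cases h1 : a = c
      · subst h1
        split_ifs <;> norm_num
      · simp only [h1, if_false]
        split_ifs <;> norm_num
    simp only [h, Finset.sum_add_distrib, Finset.sum_sub_distrib, Finset.sum_ite_eq,
      Finset.mem_univ, if_true, eq_comm (a := a') (b := a)]
    split_ifs <;> norm_num
  exact Finset.sum_congr rfl fun b _ => key (z b) (z' b)

theorem exists_vec_blockDir (hn : 0 < n) (z : Fin (n / 4) → Fin 4) {κ : ℝ} (h0 : 0 ≤ κ)
    (h1 : κ ≤ 1) : ∃ p : PMF (Fin n), vec p = fun i => (1 + κ * blockDir z i) / n := by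
  have hn' : (n : ℝ) ≠ 0 := Nat.cast_ne_zero.2 hn.ne'
  refine exists_vec_eq _ (fun i => ?_) ?_
  · have := mul_le_mul_of_nonneg_left (neg_one_le_blockDir z i) h0
    exact div_nonneg (by linarith) (by positivity)
  · rw [← Finset.sum_div, Finset.sum_add_distrib, ← Finset.mul_sum,
      sum_blockDir_comp z (fun x => x) rfl]
    simp [hn']

theorem tv_blockDir [NeZero n] (z : Fin (n / 4) → Fin 4) {κ : ℝ} (h0 : 0 ≤ κ)
    {p : PMF (Fin n)} (hp : vec p = fun i => (1 + κ * blockDir z i) / n) :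
    tv p (PMF.uniformOfFintype (Fin n)) = 3 * κ * (n / 4 : ℕ) / n := by
  rw [tv_eq_half, hp]
  have : ∀ i, |(1 + κ * blockDir z i) / n - vec (PMF.uniformOfFintype (Fin n)) i| =
      κ / n * |blockDir z i| := by
    intro i
    rw [vec_uniform, ← sub_div, add_sub_cancel_left, abs_div, abs_mul, abs_of_nonneg h0,
      Nat.abs_cast]
    ring
  simp only [this]
  rw [← Finset.mul_sum, sum_blockDir_comp z abs abs_zero]
  norm_num
  ring

/-- For fixed `z` the sum over `z'` factors over blocks, each with one agreeing and three
disagreeing choices, so it does not depend on `z`. -/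
theorem sum_exp_blocks (k : ℕ) (t : ℝ) :
    ∑ z : Fin k → Fin 4, ∑ z' : Fin k → Fin 4,
      Real.exp (t * ∑ b, if z b = z' b then 12 else -4) =
      ((4 : ℝ) ^ k) * (Real.exp (t * 12) + 3 * Real.exp (t * (-4))) ^ k := by
  have h : ∀ z : Fin k → Fin 4, ∑ z' : Fin k → Fin 4,
      Real.exp (t * ∑ b, if z b = z' b then 12 else -4) =
      (Real.exp (t * 12) + 3 * Real.exp (t * (-4))) ^ k := by
    intro z
    simp only [Finset.mul_sum, Real.exp_sum]
    rw [← Fintype.prod_sum fun b c => Real.exp (t * if z b = c then 12 else -4)]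
    have : ∀ a : Fin 4, ∑ c, Real.exp (t * if a = c then 12 else -4) =
        Real.exp (t * 12) + 3 * Real.exp (t * (-4)) := by
      intro a
      fin_cases a <;> simp [Fin.sum_univ_four] <;> ring
    simp only [this, Finset.prod_const, Finset.card_univ, Fintype.card_fin]
  simp [h]

/-- Use `exp y ≤ 1 + y + y ^ 2` for `|y| ≤ 1`: the linear terms cancel, and `(144 + 3 * 16) / 4 =
48`. -/
theorem exp_block_le {t : ℝ} (h0 : 0 ≤ t) (h1 : t ≤ 1 / 12) :
    Real.exp (t * 12) + 3 * Real.exp (t * (-4)) ≤ 4 * Real.exp (48 * t ^ 2) := by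
  have a := (abs_le.1 (Real.abs_exp_sub_one_sub_id_le
    (abs_le.2 ⟨by linarith, (by linarith : t * 12 ≤ 1)⟩))).2
  have b := (abs_le.1 (Real.abs_exp_sub_one_sub_id_le
    (abs_le.2 ⟨(by linarith : -1 ≤ t * (-4)), by linarith⟩))).2
  have c := Real.add_one_le_exp (48 * t ^ 2)
  nlinarith

theorem exists_far_of_blocks [NeZero n] (hn : 12 ≤ n) {ε γ c : ℝ} (hε : 0 < ε) (hε1 : ε ≤ 1 / 2)
    (hγ0 : 0 ≤ γ) (hc : c ≤ 1 / 160) (hcγ : 20 * c ≤ γ) {m : ℕ}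
    (hm : m * ε ^ 2 < c * √(n : ℝ)) (φ : (Fin m → Fin n) → ℝ) (h0 : ∀ x, 0 ≤ φ x)
    (h1 : ∀ x, φ x ≤ 1) :
    ∃ p : PMF (Fin n), ε < tv p (PMF.uniformOfFintype (Fin n)) ∧
      iidExp (fun _ => 1 / (n : ℝ)) φ ≤ iidExp (vec p) φ + γ := by
  have hn0 : (0 : ℝ) < n := by positivity
  have hr : 1 ≤ √(n : ℝ) := Real.one_le_sqrt.2 (by exact_mod_cast (by omega : 1 ≤ n))
  have hrr : √(n : ℝ) ^ 2 = n := Real.sq_sqrt hn0.le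
  have hc0 : 0 < c := by
    by_contra h
    have h2 := mul_nonpos_of_nonpos_of_nonneg (not_lt.1 h) (by linarith : (0 : ℝ) ≤ √(n : ℝ))
    have h3 : 0 ≤ m * ε ^ 2 := by positivity
    linarith
  -- Amplitude `2 * ε` is admissible exactly because `ε ≤ 1 / 2`. It gives distance `6 * ε * ⌊n / 4⌋
  -- / n`, at least `6 * ε / 5`, since `n ≤ 5 * ⌊n / 4⌋` once `n ≥ 12`. Two-element blocks would
  -- reach at most `1 / 2`, leaving no room for the strict inequality at `ε = 1 / 2`.
  choose P hP using fun z : Fin (n / 4) → Fin 4 =>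
    exists_vec_blockDir (n := n) (by omega) z (κ := 2 * ε) (by linarith) (by linarith)
  set t : ℝ := m * (2 * ε) ^ 2 / n with ht
  have ht0 : 0 ≤ t := by positivity
  have htn : t * n = 4 * (m * ε ^ 2) := by rw [ht]; field_simp; ring
  have htr : t * √(n : ℝ) ≤ 4 * c := by
    have : t * √(n : ℝ) * √(n : ℝ) ≤ 4 * c * √(n : ℝ) := by
      rw [mul_assoc, ← sq, hrr, htn]; linarith
    exact le_of_mul_le_mul_right this (by linarith)
  have ht1 : t ≤ 1 / 12 := by nlinarith
  have htt : t ^ 2 * n ≤ 16 * c ^ 2 := by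
    have := pow_le_pow_left₀ (by positivity) htr 2
    rw [mul_pow, hrr] at this
    linarith
  have hk : ((n / 4 : ℕ) : ℝ) ≤ n / 4 := Nat.cast_div_le
  obtain ⟨z, hz⟩ := exists_iidExp_uniform_le (m := m) (η := γ ^ 2) (by omega : 0 < n)
    (fun z => vec (P z)) (fun z => sum_vec _) (by
      have hterm : ∀ z z', (n * ∑ i, vec (P z) i * vec (P z') i) ^ m ≤
          Real.exp (t * ∑ b, if z b = z' b then 12 else -4) := by
        intro z z'
        have e : n * ∑ i, vec (P z) i * vec (P z') i =
            1 + (2 * ε) ^ 2 / n * ∑ b, if z b = z' b then 12 else -4 := by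
          rw [← sum_blockDir_mul]
          have : ∀ i, vec (P z) i * vec (P z') i = 1 / (n : ℝ) ^ 2 +
              2 * ε / n ^ 2 * blockDir z i + 2 * ε / n ^ 2 * blockDir z' i +
              (2 * ε) ^ 2 / n ^ 2 * (blockDir z i * blockDir z' i) := by
            intro i; rw [hP, hP]; ring
          simp only [this, Finset.sum_add_distrib, ← Finset.mul_sum,
            sum_blockDir_comp _ (fun x => x) rfl]
          simp
          field_simp
        have hnn : 0 ≤ n * ∑ i, vec (P z) i * vec (P z') i :=
          mul_nonneg hn0.le (Finset.sum_nonneg fun i _ =>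
            mul_nonneg (vec_nonneg _ _) (vec_nonneg _ _))
        have hle : n * ∑ i, vec (P z) i * vec (P z') i ≤
            Real.exp ((2 * ε) ^ 2 / n * ∑ b, if z b = z' b then 12 else -4) := by
          rw [e, add_comm]; exact Real.add_one_le_exp _
        refine (pow_le_pow_left₀ hnn hle m).trans (le_of_eq ?_)
        rw [← Real.exp_nat_mul, ht]
        congr 1; ring
      refine (Finset.sum_le_sum fun z _ => Finset.sum_le_sum fun z' _ => hterm z z').trans ?_
      rw [sum_exp_blocks]
      have hb := pow_le_pow_left₀ (by positivity) (exp_block_le ht0 ht1) (n / 4)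
      rw [mul_pow, ← Real.exp_nat_mul] at hb
      -- With `t ^ 2 * n ≤ 16 * c ^ 2` the exponent is at most `192 * c ^ 2`; doubling it gives `384
      -- * c ^ 2 ≤ (20 * c) ^ 2 ≤ γ ^ 2`.
      have hy : (n / 4 : ℕ) * (48 * t ^ 2) ≤ 12 * (t ^ 2 * n) := by
        have := mul_le_mul_of_nonneg_right hk (by positivity : 0 ≤ 48 * t ^ 2)
        linarith
      have hcc : c ^ 2 ≤ (1 / 160) ^ 2 := pow_le_pow_left₀ hc0.le hc 2
      have hcg : (20 * c) ^ 2 ≤ γ ^ 2 := pow_le_pow_left₀ (by positivity) hcγ 2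
      have hexp := exp_le_one_add_two_mul (y := (n / 4 : ℕ) * (48 * t ^ 2)) (by positivity)
        (by linarith)
      have hfin : Real.exp ((n / 4 : ℕ) * (48 * t ^ 2)) ≤ 1 + γ ^ 2 := by linarith [sq_nonneg c]
      have h4 := mul_le_mul_of_nonneg_left (hb.trans (mul_le_mul_of_nonneg_left hfin
        (by positivity : (0 : ℝ) ≤ 4 ^ (n / 4)))) (by positivity : (0 : ℝ) ≤ 4 ^ (n / 4))
      refine h4.trans (le_of_eq ?_)
      simp only [Fintype.card_fun, Fintype.card_fin]
      push_cast
      ring) φ h0 h1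
  rw [Real.sqrt_sq hγ0] at hz
  refine ⟨P z, ?_, hz⟩
  rw [tv_blockDir z (by linarith) (hP z), lt_div_iff₀ hn0]
  have hk5 : (n : ℝ) ≤ 5 * (n / 4 : ℕ) := by exact_mod_cast (by omega : n ≤ 5 * (n / 4))
  have := mul_le_mul_of_nonneg_left hk5 hε.le
  have := mul_pos hε hn0
  linarith

end Blocks

/-! #### Far distributions that fool a test -/

section Far

variable {n : ℕ} [NeZero n]

theorem vec_uniform_eq (S : Finset (Fin n)) :
    vec (PMF.uniformOfFintype (Fin n)) = fun i => 1 / (n : ℝ) + 0 * balanced S i := by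
  funext i
  rw [vec_uniform]; ring

/-- Without samples every law looks the same, so a point mass, at distance at least `1 - 1 / n` from
uniform, serves. -/
theorem exists_far_of_zero_samples {ε γ : ℝ} (hεn : ε < 1 - 1 / (n : ℝ)) (hγ : 0 ≤ γ)
    (φ : (Fin 0 → Fin n) → ℝ) :
    ∃ p : PMF (Fin n), ε < tv p (PMF.uniformOfFintype (Fin n)) ∧
      iidExp (fun _ => 1 / (n : ℝ)) φ ≤ iidExp (vec p) φ + γ := by
  refine ⟨PMF.pure 0, hεn.trans_le ?_, ?_⟩
  · refine le_trans (le_trans ?_ (le_abs_self _)) (abs_mass_sub_le_tv _ _ {0})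
    simp [mass]
  · simp only [iidExp, Finset.univ_eq_empty, Finset.prod_empty]
    linarith

theorem exists_far_of_pos {ε γ c : ℝ} (hε : 0 < ε) (hε1 : ε ≤ 1 / 2)
    (hεn : ε < 1 - 1 / (n : ℝ)) (hγ0 : 0 < γ) (hγ1 : γ ≤ 1) (hc : 160 * c ≤ γ ^ 2) {m : ℕ}
    (hm : m * ε ^ 2 < c * √(n : ℝ)) (φ : (Fin m → Fin n) → ℝ) (h0 : ∀ x, 0 ≤ φ x)
    (h1 : ∀ x, φ x ≤ 1) :
    ∃ p : PMF (Fin n), ε < tv p (PMF.uniformOfFintype (Fin n)) ∧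
      iidExp (fun _ => 1 / (n : ℝ)) φ ≤ iidExp (vec p) φ + γ := by
  have hγ2 : γ ^ 2 ≤ 1 := pow_le_one₀ hγ0.le hγ1
  have hγ3 : γ ^ 2 ≤ γ := by nlinarith
  rcases le_or_gt 12 n with hn | hn
  · exact exists_far_of_blocks hn hε hε1 hγ0.le (by linarith) (by linarith) hm φ h0 h1
  · have hn2 : 2 ≤ n := by
      by_contra h
      have : n = 1 := by have := NeZero.ne n; omega
      subst this
      norm_num at hεn
      linarith
    rcases Nat.eq_zero_or_pos m with rfl | hm0
    · exact exists_far_of_zero_samples hεn hγ0.le φ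
    · have hm1 : (1 : ℝ) ≤ m := by exact_mod_cast hm0
      have hr : √(n : ℝ) ≤ 4 := by
        rw [Real.sqrt_le_left (by norm_num)]
        have : (n : ℝ) ≤ 12 := by exact_mod_cast hn.le
        linarith
      have hc0 : 0 < c := by
        by_contra h
        have h2 := mul_nonpos_of_nonpos_of_nonneg (not_lt.1 h) (Real.sqrt_nonneg (n : ℝ))
        have h3 : 0 ≤ m * ε ^ 2 := by positivity
        linarith
      have hcr := mul_le_mul_of_nonneg_left hr hc0.le
      -- One sample already forces `ε ^ 2 < 4 * c ≤ 1 / 40`, so the balanced law at distance `2 * ε`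
      -- exists. Fooling the test needs `40 * m * ε ^ 2 ≤ γ ^ 2`, which follows from `m * ε ^ 2 < 4
      -- * c`: this is the source of the constant 160.
      have hε2 : ε ≤ 1 / 4 := by
        have := mul_le_mul_of_nonneg_right hm1 (sq_nonneg ε)
        nlinarith
      obtain ⟨S, hS, hfam⟩ := exists_balanced_family hn2
      obtain ⟨p, hp⟩ := hfam (2 * ε) (by linarith) (by linarith)
      refine ⟨p, ?_, iidExp_uniform_le_balanced hn2 hS hp hγ0.le hγ1 (by linarith) φ h0 h1⟩
      rw [tv_balanced hn2 hS hp (vec_uniform_eq S), sub_zero,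
        abs_of_pos (by linarith)]
      linarith

theorem exists_far {ε γ c : ℝ} (hε : 0 ≤ ε) (hε1 : ε ≤ 1 / 2)
    (hεn : ε < 1 - 1 / (n : ℝ)) (hγ0 : 0 < γ) (hγ1 : γ ≤ 1) (hc0 : 0 < c)
    (hc : 160 * c ≤ γ ^ 2) {m : ℕ} (hm : (m : ℝ≥0∞) < ENNReal.ofReal c * standardRate n ε)
    (φ : (Fin m → Fin n) → ℝ) (h0 : ∀ x, 0 ≤ φ x) (h1 : ∀ x, φ x ≤ 1) :
    ∃ p : PMF (Fin n), ε < tv p (PMF.uniformOfFintype (Fin n)) ∧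
      iidExp (fun _ => 1 / (n : ℝ)) φ ≤ iidExp (vec p) φ + γ := by
  have hn0 : (0 : ℝ) < n := Nat.cast_pos.2 (NeZero.pos n)
  rcases hε.eq_or_lt with rfl | hε
  · have ht : Filter.Tendsto (fun x : ℝ => m * x ^ 2) (nhdsWithin 0 (Set.Ioi 0)) (nhds 0) := by
      have : Filter.Tendsto (fun x : ℝ => m * x ^ 2) (nhds 0) (nhds (m * 0 ^ 2)) := by
        apply Continuous.tendsto; fun_prop
      simpa using this.mono_left nhdsWithin_le_nhds
    have hid : Filter.Tendsto (fun x : ℝ => x) (nhdsWithin 0 (Set.Ioi 0)) (nhds 0) :=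
      nhdsWithin_le_nhds
    have hcr : 0 < c * √(n : ℝ) := mul_pos hc0 (Real.sqrt_pos.2 hn0)
    obtain ⟨ε, h2, h3, h4, h5⟩ := ((ht.eventually_lt_const hcr).and
      ((hid.eventually_lt_const (by norm_num : (0 : ℝ) < 1 / 2)).and
        ((hid.eventually_lt_const hεn).and self_mem_nhdsWithin))).exists
    obtain ⟨p, hp, hpφ⟩ := exists_far_of_pos (Set.mem_Ioi.1 h5) h3.le h4 hγ0 hγ1 hc h2 φ h0 h1
    exact ⟨p, (Set.mem_Ioi.1 h5).trans hp, hpφ⟩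
  · refine exists_far_of_pos hε hε1 hεn hγ0 hγ1 hc ?_ φ h0 h1
    rw [standardRate_eq n hε, ← ENNReal.ofReal_mul hc0.le, ← ENNReal.ofReal_natCast,
      ENNReal.ofReal_lt_ofReal_iff_of_nonneg (by positivity), ← mul_div_assoc,
      lt_div_iff₀ (by positivity)] at hm
    exact hm

end Far

/-! ### Contradiction from the probabilities of the three answers -/

section Answers

variable {n : ℕ}

theorem answer_sum (P : PMF Answer) :
    (P .accept).toReal + (P .reject).toReal + (P .inaccurate).toReal = 1 := by
  classical
  let _ : Fintype Answer := ⟨{.accept, .reject, .inaccurate}, by rintro (_ | _ | _) <;> simp⟩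
  rw [← sum_toReal P]
  change _ = ∑ i ∈ ({.accept, .reject, .inaccurate} : Finset Answer), _
  rw [Finset.sum_insert (by simp), Finset.sum_pair (by simp), add_assoc]

theorem prob_sum (A : SampleAlg n Answer) (p : PMF (Fin n)) :
    A.prob p .accept + A.prob p .reject + A.prob p .inaccurate = 1 := by
  simp only [prob_eq_iidExp]
  rw [← iidExp_add, ← iidExp_add]
  simp only [answer_sum]
  exact iidExp_const (sum_vec p) 1

variable [NeZero n]

theorem vec_uniform_fun : vec (PMF.uniformOfFintype (Fin n)) = fun _ => 1 / (n : ℝ) :=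
  funext vec_uniform

theorem samples_ge_of_tv_le {α ε δ γ c : ℝ} (hε : 0 ≤ ε) (hε1 : ε ≤ 1 / 2)
    (hεn : ε < 1 - 1 / (n : ℝ)) (hγ0 : 0 < γ) (hγ1 : γ ≤ 1) (hγδ : 3 * δ / 2 + 2 * γ < 1)
    (hc0 : 0 < c) (hc : 160 * c ≤ γ ^ 2) {phat : PMF (Fin n)}
    (hd : tv (PMF.uniformOfFintype (Fin n)) phat ≤ α) {A : SampleAlg n Answer}
    (hA : IsAugmentedFor α ε δ (PMF.uniformOfFintype (Fin n)) phat A) :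
    ENNReal.ofReal c * standardRate n ε ≤ A.samples := by
  by_contra hcon
  obtain ⟨p, hp, hpφ⟩ := exists_far hε hε1 hεn hγ0 hγ1 hc0 hc (not_le.1 hcon)
    (fun x => (A.out x .accept).toReal) (fun x => toReal_apply_nonneg _ _)
    (fun x => toReal_apply_le_one _ _)
  rw [← vec_uniform_fun, ← prob_eq_iidExp, ← prob_eq_iidExp] at hpφ
  have h1 := (hA p).2.2 hp
  have h2 := (hA (PMF.uniformOfFintype (Fin n))).1 hd
  have h3 := (hA (PMF.uniformOfFintype (Fin n))).2.1 rfl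
  have h4 := prob_sum A (PMF.uniformOfFintype (Fin n))
  linarith

theorem exists_hard_prediction {α ε δ γ c d : ℝ} (hα : 0 ≤ α) (hε : 0 ≤ ε) (hε1 : ε ≤ 1 / 2)
    (hεn : ε < 1 - 1 / (n : ℝ)) (hγ0 : 0 < γ) (hγ1 : γ ≤ 1) (hγδ : 3 * δ / 2 + 2 * γ < 1)
    (hc0 : 0 < c) (hc : 160 * c ≤ γ ^ 2) (hd : α < d) (hd1 : d ≤ 1 / 2) :
    ∃ phat : PMF (Fin n), tv (PMF.uniformOfFintype (Fin n)) phat = d ∧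
      ∀ A : SampleAlg n Answer, IsAugmentedFor α ε δ (PMF.uniformOfFintype (Fin n)) phat A →
        ENNReal.ofReal c * augmentedRate n α ε d ≤ A.samples := by
  have hn2 : 2 ≤ n := by
    by_contra h
    have : n = 1 := by have := NeZero.ne n; omega
    subst this
    norm_num at hεn
    linarith
  obtain ⟨S, hS, hfam⟩ := exists_balanced_family hn2
  -- The prediction and `p'` lie on the same ray from uniform, so their distance is exactly `d - (d
  -- - α) = α`.
  obtain ⟨phat, hphat⟩ := hfam d (by linarith) hd1
  obtain ⟨p', hp'⟩ := hfam (d - α) (by linarith) (by linarith)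
  have hU := vec_uniform_eq S
  refine ⟨phat, ?_, fun A hA => ?_⟩
  · rw [tv_balanced hn2 hS hU hphat, zero_sub, abs_neg, abs_of_nonneg (by linarith)]
  · by_contra hcon
    have hcon := not_le.1 hcon
    rw [augmentedRate_of_lt hd] at hcon
    have hm1 : (A.samples : ℝ≥0∞) < ENNReal.ofReal c * standardRate n ε :=
      hcon.trans_le (mul_le_mul_right (min_le_right _ _) _)
    have hm2 : (A.samples : ℝ≥0∞) < ENNReal.ofReal c * ENNReal.ofReal (1 / (d - α) ^ 2) :=
      hcon.trans_le (mul_le_mul_right (min_le_left _ _) _)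
    have hg : 0 < d - α := sub_pos.2 hd
    rw [← ENNReal.ofReal_mul hc0.le, ← ENNReal.ofReal_natCast,
      ENNReal.ofReal_lt_ofReal_iff_of_nonneg (by positivity), ← mul_div_assoc,
      lt_div_iff₀ (by positivity), mul_one] at hm2
    obtain ⟨p, hp, hpφ⟩ := exists_far hε hε1 hεn hγ0 hγ1 hc0 hc hm1
      (fun x => (A.out x .accept).toReal) (fun x => toReal_apply_nonneg _ _)
      (fun x => toReal_apply_le_one _ _)
    have hpφ' := iidExp_uniform_le_balanced hn2 hS hp' hγ0.le hγ1 (m := A.samples) (by linarith)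
      (fun x => (A.out x .inaccurate).toReal) (fun x => toReal_apply_nonneg _ _)
      (fun x => toReal_apply_le_one _ _)
    rw [← vec_uniform_fun, ← prob_eq_iidExp, ← prob_eq_iidExp] at hpφ hpφ'
    have htv : tv p' phat ≤ α := by
      rw [tv_balanced hn2 hS hp' hphat, sub_sub_cancel_left, abs_neg, abs_of_nonneg hα]
    have h1 := (hA p).2.2 hp
    have h2 := (hA p').1 htv
    have h3 := (hA (PMF.uniformOfFintype (Fin n))).2.1 rfl
    have h4 := prob_sum A (PMF.uniformOfFintype (Fin n))
    linarith

end Answers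

end AugTest

end

theorem theorem4p1 :
    -- Standard testers with `O(√n / ε²)` samples, as called by the algorithm, exist.
    (∃ T : (n : ℕ) → ℝ → PMF (Fin n) → AugTest.SampleAlg n AugTest.Verdict, ∃ C : ℝ≥0,
      ∀ (n : ℕ) (ε : ℝ), 0 < ε → ε ≤ 1 →
        AugTest.IsStandardIdentityTester ε (1 / 20) (T n ε) ∧
        ∀ q : PMF (Fin n), ((T n ε q).samples : ℝ≥0∞) ≤ C * AugTest.standardRate n ε) ∧
    -- Upper bound: with any such standard tester, and with any large enough constant `K` in the
    -- number of samples of the Scheffé-set branch, the algorithm is an `(α, ε, 0.1)`-augmented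
    -- tester with the claimed number of samples.
    (∃ K₀ : ℝ, 0 < K₀ ∧ ∀ K : ℝ, K₀ ≤ K → ∀ C : ℝ≥0, ∃ C' : ℝ≥0,
      ∀ T : (n : ℕ) → ℝ → PMF (Fin n) → AugTest.SampleAlg n AugTest.Verdict,
        (∀ (n : ℕ) (ε : ℝ), 0 < ε → ε ≤ 1 →
          AugTest.IsStandardIdentityTester ε (1 / 20) (T n ε) ∧
          ∀ q : PMF (Fin n), ((T n ε q).samples : ℝ≥0∞) ≤ C * AugTest.standardRate n ε) →
        ∀ (n : ℕ) (α ε : ℝ), 0 ≤ α → α ≤ 1 → 0 < ε → ε ≤ 1 →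
          AugTest.IsAugmentedIdentityTester α ε (1 / 10)
            (AugTest.augmentedIdentityTester K (T n ε) α ε) ∧
          ∀ q phat : PMF (Fin n),
            ((AugTest.augmentedIdentityTester K (T n ε) α ε q phat).samples : ℝ≥0∞) ≤
              C' * AugTest.augmentedRate n α ε (AugTest.tv q phat)) ∧
    -- Lower bound, already for uniform `q`, with a constant that depends only on `δ`.
    (∀ δ : ℝ, 0 < δ → δ < 2 / 3 → ∃ c : ℝ≥0, 0 < c ∧
      ∀ (n : ℕ) [NeZero n] (α ε : ℝ), 0 ≤ α → α ≤ 1 → 0 ≤ ε → ε ≤ 1 / 2 → ε < 1 - 1 / (n : ℝ) →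
        -- The case `d ≤ α`, for every prediction.
        (∀ phat : PMF (Fin n), AugTest.tv (PMF.uniformOfFintype (Fin n)) phat ≤ α →
          ∀ A : AugTest.SampleAlg n AugTest.Answer,
            AugTest.IsAugmentedFor α ε δ (PMF.uniformOfFintype (Fin n)) phat A →
            c * AugTest.augmentedRate n α ε (AugTest.tv (PMF.uniformOfFintype (Fin n)) phat) ≤
              (A.samples : ℝ≥0∞)) ∧
        -- The case `α < d`: for every value of `d` there is a prediction that is hard.
        (∀ d : ℝ, α < d → d ≤ 1 / 2 →
          ∃ phat : PMF (Fin n), AugTest.tv (PMF.uniformOfFintype (Fin n)) phat = d ∧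
            ∀ A : AugTest.SampleAlg n AugTest.Answer,
              AugTest.IsAugmentedFor α ε δ (PMF.uniformOfFintype (Fin n)) phat A →
              c * AugTest.augmentedRate n α ε d ≤ (A.samples : ℝ≥0∞))) := by
  refine ⟨⟨AugTest.pairTester, 802, fun n ε hε hε1 =>
    ⟨AugTest.pairTester_isStandardIdentityTester n hε hε1,
      AugTest.pairTester_samples_le n hε hε1⟩⟩, ⟨80, by norm_num, fun K hK C =>
    ⟨C + Real.toNNReal (K + 1), fun T hT n α ε hα _ hε hε1 =>
      ⟨AugTest.augmentedIdentityTester_correct hK (T n ε) (hT n ε hε hε1).1,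
        AugTest.augmentedIdentityTester_samples_le (by linarith) hα hε C (T n ε)
          (hT n ε hε hε1).2⟩⟩⟩, ?_⟩
  intro δ hδ0 hδ
  -- This is `γ`: it leaves `3 * δ / 2 + 2 * γ = 1 - 2 * γ < 1`. The constant of the lower bound is
  -- `γ ^ 2 / 160`.
  have hγ0 : 0 < (1 - 3 * δ / 2) / 4 := by linarith
  have hc0 : 0 < ((1 - 3 * δ / 2) / 4) ^ 2 / 160 := by positivity
  refine ⟨Real.toNNReal (((1 - 3 * δ / 2) / 4) ^ 2 / 160), Real.toNNReal_pos.2 hc0, ?_⟩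
  intro n _ α ε hα _ hε hε1 hεn
  refine ⟨fun phat hd A hA => ?_, fun d hd hd1 => ?_⟩
  · rw [AugTest.augmentedRate_of_le hd]
    exact AugTest.samples_ge_of_tv_le hε hε1 hεn hγ0 (by linarith) (by linarith) hc0
      (by linarith) hd hA
  · exact AugTest.exists_hard_prediction hα hε hε1 hεn hγ0 (by linarith) (by linarith) hc0
      (by linarith) hd hd1
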